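/- Set multicover with multiplicity constraints. There are $m$ sets (variables), and a solution is a vector $z\in\{0,1\}^m$ with cost $\langle \mathbf 1,z\rangle$, so that each set can be bought at most once. A request is a constraint $\langle a,z\rangle\ge b$ with $a\in\{0,1\}^m$ and $b\in\mathbb Z_{\ge 0}$ that some $z\in\{0,1\}^m$ satisfies (i.e. $b\le\langle \mathbf 1,a\rangle$). For requests $v^1,\dots,v^n$, let $\mathrm{OPT}(v^1,\dots,v^n)$ be the least cost of a solution that satisfies all of them. A (randomized) online algorithm maintains a coordinatewise nondecreasing solution $z$; requests arrive one at a time, and on its arrival each request must be satisfied immediately, so that at every moment all the requests that have arrived are satisfied. There is an absolute constant $C>0$ such that for all $m,n\in\mathbb N$ with $mn\ge 2$ the following hold, where the algorithms may depend on $m$, $n$ and on the parameters $\lambda$ and $\alpha$. 1. (Single-sample prophet setting.) There is a randomized online algorithm that is given one sample from each of $n$ unknown distributions $D^1,\dots,D^n$ on requests before the online sequence begins, and whose expected cost on the sequence $v^1,\dots,v^n$ is at most $C\log(mn)\cdot\mathbb E[\mathrm{OPT}(v^1,\dots,v^n)]$. Here the samples and the requests $v^t\sim D^t$ are all independent, the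 expectation is over the samples, the requests and the randomness of the algorithm, and the bound holds for all $D^1,\dots,D^n$. 2. (2-stage prophet setting.) Let $\lambda>0$ be real. Sets bought before the online sequence begins cost $1$ each, and further sets bought during the online sequence cost $\lambda$ each. There is a randomized online algorithm that is given $\lceil\lambda\rceil$ independent samples from each of $n$ unknown distributions $D^1,\dots,D^n$ before it buys anything, and whose expected total cost on independent requests $v^t\sim D^t$ (arriving in the order $t=1,\dots,n$, independently of the samples) is, for all $D^1,\dots,D^n$, at most $C\log(mn)$ times the expected total cost of every online policy that serves the random sequence almost surely. Such a policy may depend on $D^1,\dots,D^n$ and may be randomized. In other words, the algorithm is $C\log(mn)$-competitive with respect to the optimal online policy. 3. (Online-with-a-sample setting.) Let $0<\alpha\le 1$. An adversary fixes requests $v^1,\dots,v^n$; a uniformly random set $S$ of $\lfloor\alpha n\rfloor$ of the $n$ positions is drawn, and the multiset of the requests at the positions in $S$ is revealed to the algorithm, which must satisfy these requests upfront; then the other requests arrive one by one in an order chosen by the adversary, which may depend on $S$. There is a randomized online algorithm whose expected cost is at most $\frac{C\log(mn)}{\alpha}\cdot\mathrm{OPT}(v^1,\dots,v^n)$ for all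 $v^1,\dots,v^n$ and all such orders. -/

import Mathlib

open scoped ENNReal

namespace SetMulticover

/-- One constraint `⟨a, z⟩ ≥ b` of a set multicover program with `m` sets (variables).
The row `a ∈ {0,1}^m` is given by its support and `b` is a nonnegative integer.
The last field says that the constraint can be satisfied by some `z ∈ {0,1}^m`. -/
structure Request (m : ℕ) where
  row : Finset (Fin m)
  demand : ℕ
  satisfiable : demand ≤ row.card

/-- The 0/1 solution with support `z` satisfies the constraint. Each set can be used only once,
so this is `⟨a, z⟩ ≥ b`. -/
def Request.SatisfiedBy {m : ℕ} (r : Request m) (z : Finset (Fin m)) : Prop :=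
  r.demand ≤ (r.row ∩ z).card

/-- The offline optimum: the least number of sets in a 0/1 solution that satisfies all the given
requests. -/
noncomputable def opt {m : ℕ} {ι : Type} (v : ι → Request m) : ℝ≥0∞ :=
  ⨅ (z : Finset (Fin m)) (_ : ∀ i, (v i).SatisfiedBy z), (z.card : ℝ≥0∞)

/-- The expectation of `f` under a discrete distribution. -/
noncomputable def expect {Ω : Type} (p : PMF Ω) (f : Ω → ℝ≥0∞) : ℝ≥0∞ :=
  ∑' ω, p ω * f ω

/-- The expectation of `f v` where the coordinates `v i ∼ D i` are drawn independently. -/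
noncomputable def expectIndep {ι Ω : Type} [Fintype ι] (D : ι → PMF Ω) (f : (ι → Ω) → ℝ≥0∞) :
    ℝ≥0∞ :=
  ∑' v : ι → Ω, (∏ i, D i (v i)) * f v

/-- A randomized online algorithm for set multicover with `m` sets which is given some information
in `Info` (for instance samples) upfront. It draws a random seed, buys the sets in `initial` before
the online sequence begins, and buys the sets in `buy` whenever a request arrives. The list
argument of `buy` is the list of the requests that have arrived so far; its last entry is the
request that arrives at this moment. -/
structure OnlineAlgorithm (m : ℕ) (Info : Type) where
  Seed : Type
  law : PMF Seed
  initial : Seed → Info → Finset (Fin m)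
  buy : Seed → Info → List (Request m) → Finset (Fin m)

namespace OnlineAlgorithm

variable {m : ℕ} {Info : Type}

/-- All sets bought in response to the requests of the list `l`, in this order. -/
def online (A : OnlineAlgorithm m Info) (ω : A.Seed) (s : Info) (l : List (Request m)) :
    Finset (Fin m) :=
  (Finset.range l.length).biUnion fun j => A.buy ω s (l.take (j + 1))

/-- The solution held after the requests of the list `l` have arrived. It grows with `l`, since
purchases are irrevocable. -/
def held (A : OnlineAlgorithm m Info) (ω : A.Seed) (s : Info) (l : List (Request m)) :
    Finset (Fin m) :=
  A.initial ω s ∪ A.online ω s l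

/-- At every moment of the online sequence `l`, all the requests that have arrived by then are
satisfied. -/
def Serves (A : OnlineAlgorithm m Info) (ω : A.Seed) (s : Info) (l : List (Request m)) : Prop :=
  ∀ l' : List (Request m), l' <+: l → ∀ r ∈ l', r.SatisfiedBy (A.held ω s l')

/-- The algorithm serves every online sequence, whatever the information given upfront and
whatever its random seed. -/
def AlwaysServes (A : OnlineAlgorithm m Info) : Prop :=
  ∀ (ω : A.Seed) (s : Info) (l : List (Request m)), A.Serves ω s l

/-- The expected number of sets bought on the information `s` and the sequence `l`. -/
noncomputable def cost (A : OnlineAlgorithm m Info) (s : Info) (l : List (Request m)) : ℝ≥0∞ :=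
  expect A.law fun ω => ((A.held ω s l).card : ℝ≥0∞)

/-- The expected cost on the information `s` and the sequence `l` if each set bought before the
online sequence costs `1` and each further set bought during the online sequence costs `c`. -/
noncomputable def twoStageCost (A : OnlineAlgorithm m Info) (c : ℝ≥0∞) (s : Info)
    (l : List (Request m)) : ℝ≥0∞ :=
  expect A.law fun ω =>
    ((A.initial ω s).card : ℝ≥0∞) + c * ((A.online ω s l \ A.initial ω s).card : ℝ≥0∞)

end OnlineAlgorithm

/-- An algorithm that is given `k` samples from each of `n` distributions; the sample `(i, t)`
is the `i`-th sample from the `t`-th distribution. -/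
abbrev SampleAlgorithm (m n k : ℕ) := OnlineAlgorithm m (Fin k × Fin n → Request m)

/-- The expected cost of an algorithm in the `k`-sample prophet setting: the samples
and the online requests `v t ∼ D t` are all drawn independently. -/
noncomputable def prophetCost {m n k : ℕ} (A : SampleAlgorithm m n k)
    (D : Fin n → PMF (Request m)) : ℝ≥0∞ :=
  expectIndep (fun p : Fin k × Fin n => D p.2) fun s =>
    expectIndep D fun v => A.cost s (List.ofFn v)

/-- The expected cost of an algorithm in the 2-stage prophet setting with markup `c`, given
`k` independent samples from each distribution. -/
noncomputable def twoStageProphetCost {m n k : ℕ} (A : SampleAlgorithm m n k) (c : ℝ≥0∞)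
    (D : Fin n → PMF (Request m)) : ℝ≥0∞ :=
  expectIndep (fun p : Fin k × Fin n => D p.2) fun s =>
    expectIndep D fun v => A.twoStageCost c s (List.ofFn v)

/-- A (possibly randomized) online policy for a known sequence of distributions. -/
abbrev Policy (m : ℕ) := OnlineAlgorithm m Unit

/-- The policy serves the random sequence `v t ∼ D t` almost surely. -/
def Policy.ServesAlmostSurely {m n : ℕ} (B : Policy m) (D : Fin n → PMF (Request m)) : Prop :=
  ∀ ω ∈ B.law.support, ∀ v : Fin n → Request m, (∀ t, v t ∈ (D t).support) →
    B.Serves ω () (List.ofFn v)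

/-- The expected cost of an online policy in the 2-stage prophet setting with markup `c`. -/
noncomputable def Policy.twoStageProphetCost {m n : ℕ} (B : Policy m) (c : ℝ≥0∞)
    (D : Fin n → PMF (Request m)) : ℝ≥0∞ :=
  expectIndep D fun v => B.twoStageCost c () (List.ofFn v)

/-- `σ` is an order of arrival for the requests outside the sample, where the sample is a set `S` of
positions of the input. The adversary may let the order depend on `S`. -/
def IsArrivalOrder {n : ℕ} (σ : Finset (Fin n) → List (Fin n)) : Prop :=
  ∀ S, (σ S).Nodup ∧ ∀ i, i ∈ σ S ↔ i ∉ S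

/-- The expected cost of an algorithm in the online-with-a-sample setting on the input `v`:
a uniformly random set `S` of `k` positions is drawn, the algorithm is given the multiset of
the requests at these positions, and the other requests arrive in the order `σ S`. -/
noncomputable def withSampleCost {m n : ℕ} (A : OnlineAlgorithm m (Multiset (Request m))) (k : ℕ)
    (v : Fin n → Request m) (σ : Finset (Fin n) → List (Fin n)) : ℝ≥0∞ :=
  (∑ S ∈ Finset.powersetCard k (Finset.univ : Finset (Fin n)),
    A.cost (S.val.map v) ((σ S).map v)) / (n.choose k : ℝ≥0∞)

end SetMulticover

/-! All three algorithms rest on one learner. From a list `l` of past requests it draws a random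
solution whose expected size is at most `learnerRatio m`, which is `O(log m)`, times the size of any
solution `z` of `l`. Run along any sequence served by `z`, the sum over time of the expected deficit
of the next request is at most `learnerRatio m * z.card` (`learner_card_le`, `sum_learnerLoss_le`).

The learner is the union of two independent random sets. The Bernoulli set `Y` includes each set
with a probability that doubles whenever an underserved request contains it. The Gibbs set `Z` is a
solution of `l`, drawn with weight `gibbsBase m ^ Z.card`. The deficit is at most the deficit of `Y`
times the indicator that `Z` fails. If the request is underserved, the levels inside `z` grow by at
least the deficit. Otherwise `Y` has expected deficit at most one, and the failure probability of
`Z` is at most the drop of the log partition function. A potential made of the levels on `z` and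
this drop therefore pays for all deficits (`learnerLoss_le`).

In random order, every request still to come is exchangeable with the next one. Running the learner
for a random number of steps and then topping up each later request by its deficit thus costs only a
constant factor more, provided that the run length ranges over a constant fraction of the sequence
(`sum_learnerLoss_remaining_le`).

With a random sample of positions this applies directly. In the prophet settings, an online request
must take the place of a sample that the run has not read. `twoRuns` takes a short prefix and the
disjoint suffix of equal length, so every sample is unread by at least one of the two runs, and a
fresh draw can be exchanged with it (`expectIndep_twoRuns_le`). For the 2-stage setting, serving all
`⌈λ⌉` rows of samples with the decisions of a policy shows that the optimum of the samples is at
most its first-stage cost plus `⌈λ⌉` times its number of online purchases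
(`expectIndep_opt_le_policy`). -/

namespace SetMulticover

/-! ### Expectations under discrete distributions. -/

section Expectation

variable {Ω Ω' : Type}

theorem expect_pure (a : Ω) (f : Ω → ℝ≥0∞) : expect (PMF.pure a) f = f a := by
  rw [expect, tsum_eq_single a]
  · simp
  · intro b hb
    simp [PMF.pure_apply_of_ne _ _ hb]

theorem expect_bind (p : PMF Ω) (q : Ω → PMF Ω') (f : Ω' → ℝ≥0∞) :
    expect (p.bind q) f = expect p fun a => expect (q a) f := by
  simp only [expect, PMF.bind_apply, ← ENNReal.tsum_mul_right, ← ENNReal.tsum_mul_left]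
  rw [ENNReal.tsum_comm]
  simp only [mul_assoc]

theorem expect_map (p : PMF Ω) (g : Ω → Ω') (f : Ω' → ℝ≥0∞) :
    expect (p.map g) f = expect p fun a => f (g a) := by
  rw [← PMF.bind_pure_comp, expect_bind]
  simp only [Function.comp_apply, expect_pure]

theorem expect_mono_support (p : PMF Ω) {f g : Ω → ℝ≥0∞} (h : ∀ a ∈ p.support, f a ≤ g a) :
    expect p f ≤ expect p g := by
  refine ENNReal.tsum_le_tsum fun a => ?_
  by_cases ha : p a = 0
  · simp [ha]
  · exact mul_le_mul_right (h a ((p.mem_support_iff a).2 ha)) _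

theorem expect_mono (p : PMF Ω) {f g : Ω → ℝ≥0∞} (h : ∀ a, f a ≤ g a) :
    expect p f ≤ expect p g :=
  expect_mono_support p fun a _ => h a

theorem expect_const (p : PMF Ω) (c : ℝ≥0∞) : expect p (fun _ => c) = c := by
  simp [expect, ENNReal.tsum_mul_right]

theorem expect_add (p : PMF Ω) (f g : Ω → ℝ≥0∞) :
    expect p (fun a => f a + g a) = expect p f + expect p g := by
  simp only [expect, mul_add, ENNReal.tsum_add]

theorem expect_mul_left (p : PMF Ω) (c : ℝ≥0∞) (f : Ω → ℝ≥0∞) :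
    expect p (fun a => c * f a) = c * expect p f := by
  simp only [expect, ← ENNReal.tsum_mul_left, mul_left_comm]

theorem expect_mul_right (p : PMF Ω) (f : Ω → ℝ≥0∞) (c : ℝ≥0∞) :
    expect p (fun a => f a * c) = expect p f * c := by
  simp only [mul_comm _ c, expect_mul_left]

theorem expect_sum {ι : Type*} (s : Finset ι) (p : PMF Ω) (f : ι → Ω → ℝ≥0∞) :
    expect p (fun a => ∑ i ∈ s, f i a) = ∑ i ∈ s, expect p (f i) := by
  simp only [expect, Finset.mul_sum]
  exact Summable.tsum_finsetSum fun _ _ => ENNReal.summable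

theorem expect_comm (p : PMF Ω) (q : PMF Ω') (f : Ω → Ω' → ℝ≥0∞) :
    (expect p fun a => expect q fun b => f a b) = expect q fun b => expect p fun a => f a b := by
  simp only [expect, ← ENNReal.tsum_mul_left]
  rw [ENNReal.tsum_comm]
  simp only [mul_left_comm]

theorem expect_eq_sum [Fintype Ω] (p : PMF Ω) (f : Ω → ℝ≥0∞) :
    expect p f = ∑ a, p a * f a :=
  tsum_fintype _

theorem expect_uniformOfFintype [Fintype Ω] [Nonempty Ω] (f : Ω → ℝ≥0∞) :
    expect (PMF.uniformOfFintype Ω) f = (Fintype.card Ω : ℝ≥0∞)⁻¹ * ∑ a, f a := by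
  simp only [expect_eq_sum, PMF.uniformOfFintype_apply, Finset.mul_sum]

theorem expect_uniformOfFintype_equiv [Fintype Ω] [Nonempty Ω] (φ : Ω ≃ Ω) (f : Ω → ℝ≥0∞) :
    (expect (PMF.uniformOfFintype Ω) fun a => f (φ a)) = expect (PMF.uniformOfFintype Ω) f := by
  simp only [expect_uniformOfFintype]
  rw [Equiv.sum_comp φ f]

end Expectation

/-! ### Independent families and resampling of one coordinate. -/

section Product

variable {ι Ω : Type} [Fintype ι] [Fintype Ω]

/-- The product of finitely many distributions on a finite type. -/
noncomputable def productPMF (D : ι → PMF Ω) : PMF (ι → Ω) := by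
  classical
  exact PMF.ofFintype (fun v => ∏ i, D i (v i)) (by
    rw [← Fintype.piFinset_univ, ← Finset.prod_univ_sum]
    refine Finset.prod_eq_one fun i _ => ?_
    rw [← tsum_fintype (L := SummationFilter.unconditional _)]
    exact (D i).tsum_coe)

theorem productPMF_apply (D : ι → PMF Ω) (v : ι → Ω) : productPMF D v = ∏ i, D i (v i) := rfl

theorem expectIndep_eq_expect (D : ι → PMF Ω) (f : (ι → Ω) → ℝ≥0∞) :
    expectIndep D f = expect (productPMF D) f := rfl

theorem mem_support_productPMF {D : ι → PMF Ω} {v : ι → Ω} :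
    v ∈ (productPMF D).support ↔ ∀ i, v i ∈ (D i).support := by
  simp [PMF.mem_support_iff, productPMF_apply, Finset.prod_eq_zero_iff]

/-- Drawing one coordinate of an independent family again does not change the distribution. -/
theorem expectIndep_resample [DecidableEq ι] (D : ι → PMF Ω) (p : ι) (f : (ι → Ω) → ℝ≥0∞) :
    (expectIndep D fun s => expect (D p) fun x => f (Function.update s p x)) = expectIndep D f := by
  classical
  simp only [expectIndep_eq_expect, expect_eq_sum, productPMF_apply]
  rw [← (Equiv.funSplitAt p Ω).symm.sum_comp, ← (Equiv.funSplitAt p Ω).symm.sum_comp,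
    Fintype.sum_prod_type, Fintype.sum_prod_type]
  have hprod : ∀ (y : Ω) (u : {j // j ≠ p} → Ω),
      ∏ i, D i ((Equiv.funSplitAt p Ω).symm (y, u) i) = D p y * ∏ i, D i.1 (u i) := by
    intro y u
    rw [Fintype.prod_eq_mul_prod_subtype_ne _ p]
    congr 1
    · simp
    · refine Finset.prod_congr rfl fun i _ => ?_
      simp [i.2]
  have hupd : ∀ (y x : Ω) (u : {j // j ≠ p} → Ω),
      Function.update ((Equiv.funSplitAt p Ω).symm (y, u)) p x =
        (Equiv.funSplitAt p Ω).symm (x, u) := by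
    intro y x u
    ext j
    by_cases hj : j = p
    · subst hj; simp
    · simp [hj]
  simp only [hprod, hupd]
  have hone : ∑ y, D p y = 1 := by
    rw [← tsum_fintype (L := SummationFilter.unconditional _)]
    exact (D p).tsum_coe
  calc _ = ∑ y, D p y * ∑ u : {j // j ≠ p} → Ω, (∏ i, D i.1 (u i)) *
        ∑ x, D p x * f ((Equiv.funSplitAt p Ω).symm (x, u)) := by
        simp only [Finset.mul_sum, mul_assoc]
    _ = ∑ u : {j // j ≠ p} → Ω, (∏ i, D i.1 (u i)) *
        ∑ x, D p x * f ((Equiv.funSplitAt p Ω).symm (x, u)) := by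
        rw [← Finset.sum_mul, hone, one_mul]
    _ = _ := by
        simp only [Finset.mul_sum]
        rw [Finset.sum_comm]
        refine Finset.sum_congr rfl fun x _ => Finset.sum_congr rfl fun u _ => ?_
        ring

theorem expectIndep_coordinate (D : ι → PMF Ω) (p : ι) (f : Ω → ℝ≥0∞) :
    (expectIndep D fun s => f (s p)) = expect (D p) f := by
  classical
  rw [← expectIndep_resample D p]
  simp only [Function.update_self]
  rw [expectIndep_eq_expect, expect_const]

/-- A quantity that is computed without the coordinate `p` does not distinguish that coordinate
from a fresh draw. -/
theorem expectIndep_fresh [DecidableEq ι] (D : ι → PMF Ω) (p : ι) (F : (ι → Ω) → Ω → ℝ≥0∞)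
    (hF : ∀ s x, F (Function.update s p x) = F s) :
    (expectIndep D fun s => expect (D p) (F s)) = expectIndep D fun s => F s (s p) := by
  rw [← expectIndep_resample D p fun s => F s (s p)]
  simp only [hF, Function.update_self]

/-- The rows of an independent array are independent. -/
theorem expectIndep_row {κ : Type} [Fintype κ] (D : ι → PMF Ω) (i : κ)
    (f : (ι → Ω) → ℝ≥0∞) :
    (expectIndep (fun p : κ × ι => D p.2) fun s => f fun t => s (i, t)) = expectIndep D f := by
  classical
  rw [expectIndep_eq_expect D f, ← expectIndep_coordinate (fun _ : κ => productPMF D) i f]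
  simp only [expectIndep_eq_expect, expect_eq_sum, productPMF_apply]
  rw [← (Equiv.curry κ ι Ω).sum_comp]
  refine Finset.sum_congr rfl fun s _ => ?_
  rw [Fintype.prod_prod_type]
  rfl

/-- A family of distributions on a finite index set is realized by one random seed. -/
theorem exists_seed (κ : ι → PMF Ω) :
    ∃ law : PMF (ι → Ω), ∀ (s : ι) (f : Ω → ℝ≥0∞),
      (expect law fun ω => f (ω s)) = expect (κ s) f :=
  ⟨productPMF κ, fun s f => expectIndep_coordinate κ s f⟩

end Product

/-! ### Deficits of requests. -/

variable {m : ℕ}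

/-- The number of sets that have to be added to `z` in order to satisfy the request. -/
def Request.deficit (r : Request m) (z : Finset (Fin m)) : ℕ :=
  r.demand - (r.row ∩ z).card

theorem Request.deficit_eq_zero_iff {r : Request m} {z : Finset (Fin m)} :
    r.deficit z = 0 ↔ r.SatisfiedBy z := by
  simp [Request.deficit, Request.SatisfiedBy, Nat.sub_eq_zero_iff_le]

theorem Request.deficit_anti (r : Request m) {y z : Finset (Fin m)} (h : y ⊆ z) :
    r.deficit z ≤ r.deficit y := by
  have := Finset.card_le_card (Finset.inter_subset_inter (Finset.Subset.refl r.row) h)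
  unfold Request.deficit
  omega

theorem Request.deficit_le_demand (r : Request m) (z : Finset (Fin m)) :
    r.deficit z ≤ r.demand :=
  Nat.sub_le _ _

theorem Request.SatisfiedBy.mono {r : Request m} {y z : Finset (Fin m)} (hy : r.SatisfiedBy y)
    (h : y ⊆ z) : r.SatisfiedBy z :=
  le_trans hy (Finset.card_le_card (Finset.inter_subset_inter (Finset.Subset.refl _) h))

theorem Request.satisfiedBy_univ (r : Request m) : r.SatisfiedBy Finset.univ := by
  simpa [Request.SatisfiedBy] using r.satisfiable

theorem Request.SatisfiedBy.demand_le_card {r : Request m} {z : Finset (Fin m)}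
    (h : r.SatisfiedBy z) : r.demand ≤ z.card :=
  le_trans h (Finset.card_le_card Finset.inter_subset_right)

/-! ### Independent rounding and its expected deficit. -/

section Bernoulli

/-- The probability of the set `Y` if each `i` is included independently with probability `p i`. -/
noncomputable def bernoulliWeight (p : Fin m → ℝ) (Y : Finset (Fin m)) : ℝ :=
  (∏ i ∈ Y, p i) * ∏ i ∈ Yᶜ, (1 - p i)

theorem sum_prod_mul_prod_compl {R : Type*} [CommSemiring R] (f g : Fin m → R) :
    ∑ Y : Finset (Fin m), (∏ i ∈ Y, f i) * ∏ i ∈ Yᶜ, g i = ∏ i, (f i + g i) := by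
  rw [Finset.prod_add, Finset.powerset_univ]
  simp [Finset.compl_eq_univ_sdiff]

theorem bernoulliWeight_nonneg {p : Fin m → ℝ} (h0 : ∀ i, 0 ≤ p i) (h1 : ∀ i, p i ≤ 1)
    (Y : Finset (Fin m)) : 0 ≤ bernoulliWeight p Y :=
  mul_nonneg (Finset.prod_nonneg fun i _ => h0 i)
    (Finset.prod_nonneg fun i _ => sub_nonneg.2 (h1 i))

theorem sum_bernoulliWeight (p : Fin m → ℝ) : ∑ Y, bernoulliWeight p Y = 1 := by
  simp [bernoulliWeight, sum_prod_mul_prod_compl]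

theorem sum_bernoulliWeight_mem (p : Fin m → ℝ) (i : Fin m) :
    ∑ Y, bernoulliWeight p Y * (if i ∈ Y then 1 else 0) = p i := by
  have h : ∀ Y : Finset (Fin m), bernoulliWeight p Y * (if i ∈ Y then 1 else 0) =
      (∏ j ∈ Y, p j) * ∏ j ∈ Yᶜ, (if j = i then 0 else 1 - p j) := by
    intro Y
    by_cases hi : i ∈ Y
    · rw [if_pos hi, mul_one, bernoulliWeight]
      congr 1
      refine Finset.prod_congr rfl fun j hj => ?_
      rw [if_neg]
      rintro rfl
      exact Finset.mem_compl.1 hj hi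
    · have h0 : ∏ j ∈ Yᶜ, (if j = i then 0 else 1 - p j) = 0 :=
        Finset.prod_eq_zero (Finset.mem_compl.2 hi) (if_pos rfl)
      rw [if_neg hi, h0, mul_zero, mul_zero]
  simp only [h, sum_prod_mul_prod_compl]
  rw [Fintype.prod_eq_single i]
  · simp
  · intro j hj
    simp [hj]

theorem sum_bernoulliWeight_card (p : Fin m → ℝ) :
    ∑ Y, bernoulliWeight p Y * (Y.card : ℝ) = ∑ i, p i := by
  have h : ∀ Y : Finset (Fin m), (Y.card : ℝ) = ∑ i, if i ∈ Y then (1 : ℝ) else 0 := by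
    intro Y
    simp
  simp only [h, Finset.mul_sum]
  rw [Finset.sum_comm]
  exact Finset.sum_congr rfl fun i _ => sum_bernoulliWeight_mem p i

/-- The generating function of the coverage at `1/2` factors by independence; it feeds an
exponential-moment bound on the deficit. -/
theorem sum_bernoulliWeight_half_pow (p : Fin m → ℝ) (a : Finset (Fin m)) :
    ∑ Y, bernoulliWeight p Y * (1 / 2) ^ (a ∩ Y).card = ∏ i ∈ a, (1 - p i / 2) := by
  have h : ∀ Y : Finset (Fin m), bernoulliWeight p Y * (1 / 2) ^ (a ∩ Y).card =
      (∏ j ∈ Y, p j * (if j ∈ a then 1 / 2 else 1)) * ∏ j ∈ Yᶜ, (1 - p j) := by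
    intro Y
    rw [Finset.prod_mul_distrib, Finset.prod_ite_mem, Finset.prod_const, Finset.inter_comm Y a,
      bernoulliWeight]
    ring
  simp only [h, sum_prod_mul_prod_compl]
  rw [← Finset.prod_subset (Finset.subset_univ a)]
  · refine Finset.prod_congr rfl fun i hi => ?_
    rw [if_pos hi]
    ring
  · intro i _ hi
    rw [if_neg hi]
    ring

/-- The random set that includes each `i` independently with probability `p i`. -/
noncomputable def bernoulliPMF (p : Fin m → ℝ) (h0 : ∀ i, 0 ≤ p i) (h1 : ∀ i, p i ≤ 1) :
    PMF (Finset (Fin m)) :=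
  PMF.ofFintype (fun Y => ENNReal.ofReal (bernoulliWeight p Y)) (by
    rw [← ENNReal.ofReal_sum_of_nonneg fun Y _ => bernoulliWeight_nonneg h0 h1 Y,
      sum_bernoulliWeight, ENNReal.ofReal_one])

theorem expect_ofReal {Ω : Type} [Fintype Ω] {P : PMF Ω} {w f : Ω → ℝ} (hw : ∀ a, 0 ≤ w a)
    (hf : ∀ a, 0 ≤ f a) (hP : ∀ a, P a = ENNReal.ofReal (w a)) :
    (expect P fun a => ENNReal.ofReal (f a)) = ENNReal.ofReal (∑ a, w a * f a) := by
  rw [expect_eq_sum, ENNReal.ofReal_sum_of_nonneg fun a _ => mul_nonneg (hw a) (hf a)]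
  refine Finset.sum_congr rfl fun a _ => ?_
  rw [hP, ENNReal.ofReal_mul (hw a)]

/-- A request whose residual demand is at most half of the expected coverage by the random set
has expected deficit at most one. -/
theorem sum_bernoulliWeight_deficit_le_one {p : Fin m → ℝ} (h0 : ∀ i, 0 ≤ p i)
    (h1 : ∀ i, p i ≤ 1) (r : Request m) (z : Finset (Fin m)) (hz : ∀ i ∈ z, p i = 1)
    (h : 2 * (r.deficit z : ℝ) ≤ ∑ i ∈ r.row \ z, p i) :
    ∑ Y, bernoulliWeight p Y * (r.deficit Y : ℝ) ≤ 1 := by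
  -- From `d ≤ 2 ^ d`; unlike the truncated difference, the right side has an expectation in product
  -- form.
  have hdef : ∀ Y, (r.deficit Y : ℝ) ≤ 2 ^ r.demand * (1 / 2) ^ (r.row ∩ Y).card := by
    intro Y
    rcases le_total r.demand (r.row ∩ Y).card with hle | hle
    · rw [Request.deficit, Nat.sub_eq_zero_of_le hle, Nat.cast_zero]
      positivity
    · obtain ⟨d, hd⟩ := Nat.exists_eq_add_of_le hle
      have : r.deficit Y = d := by rw [Request.deficit]; omega
      rw [this, hd, pow_add, mul_right_comm, ← mul_pow]
      norm_num
      exact_mod_cast (Nat.lt_two_pow_self).le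
  have hsplit : ∏ i ∈ r.row, (1 - p i / 2) =
      (1 / 2) ^ (r.row ∩ z).card * ∏ i ∈ r.row \ z, (1 - p i / 2) := by
    rw [← Finset.prod_inter_mul_prod_sdiff r.row z]
    congr 1
    rw [← Finset.prod_const]
    refine Finset.prod_congr rfl fun i hi => ?_
    rw [hz i (Finset.mem_inter.1 hi).2]
    norm_num
  have hexp : ∏ i ∈ r.row \ z, (1 - p i / 2) ≤ (1 / 2) ^ r.deficit z := by
    calc ∏ i ∈ r.row \ z, (1 - p i / 2) ≤ ∏ i ∈ r.row \ z, Real.exp (-(p i / 2)) := by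
          refine Finset.prod_le_prod (fun i _ => by linarith [h1 i]) fun i _ => ?_
          linarith [Real.add_one_le_exp (-(p i / 2))]
      _ = Real.exp (-((∑ i ∈ r.row \ z, p i) / 2)) := by
          rw [← Real.exp_sum, Finset.sum_neg_distrib, Finset.sum_div]
      _ ≤ Real.exp (r.deficit z * (-1)) := Real.exp_le_exp.2 (by linarith)
      _ = Real.exp (-1) ^ r.deficit z := Real.exp_nat_mul _ _
      _ ≤ _ := by
          refine pow_le_pow_left₀ (Real.exp_pos _).le ?_ _
          rw [Real.exp_neg, one_div]
          exact inv_anti₀ two_pos (by linarith [Real.add_one_le_exp (1 : ℝ)])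
  calc ∑ Y, bernoulliWeight p Y * (r.deficit Y : ℝ)
      ≤ ∑ Y, bernoulliWeight p Y * (2 ^ r.demand * (1 / 2) ^ (r.row ∩ Y).card) :=
        Finset.sum_le_sum fun Y _ =>
          mul_le_mul_of_nonneg_left (hdef Y) (bernoulliWeight_nonneg h0 h1 Y)
    _ = 2 ^ r.demand * ∏ i ∈ r.row, (1 - p i / 2) := by
        rw [← sum_bernoulliWeight_half_pow, Finset.mul_sum]
        exact Finset.sum_congr rfl fun Y _ => by ring
    _ ≤ 2 ^ r.demand * ((1 / 2) ^ (r.row ∩ z).card * (1 / 2) ^ r.deficit z) := by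
        rw [hsplit]
        gcongr
    _ ≤ 2 ^ r.demand * (1 / 2) ^ r.demand := by
        rw [← pow_add]
        refine mul_le_mul_of_nonneg_left ?_ (by positivity)
        refine pow_le_pow_of_le_one (by norm_num) (by norm_num) ?_
        unfold Request.deficit
        omega
    _ = 1 := by rw [← mul_pow]; norm_num

theorem bernoulliWeight_eq_zero {p : Fin m → ℝ} {i : Fin m} (hi : p i = 1)
    {Y : Finset (Fin m)} (hY : i ∉ Y) : bernoulliWeight p Y = 0 := by
  rw [bernoulliWeight, Finset.prod_eq_zero (Finset.mem_compl.2 hY) (by rw [hi, sub_self]), mul_zero]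

end Bernoulli

/-! ### The Gibbs distribution on feasible solutions. -/

section Gibbs

/-- The price that the Gibbs distribution puts on each set. -/
noncomputable def gibbsBase (m : ℕ) : ℝ := (1 / (2 * m)) ^ 2

open scoped Classical in
/-- The unnormalized Gibbs weight of `Z`, which vanishes unless `Z` satisfies the requests of the
list `l`. -/
noncomputable def gibbsWeight (l : List (Request m)) (Z : Finset (Fin m)) : ℝ :=
  if ∀ r ∈ l, r.SatisfiedBy Z then gibbsBase m ^ Z.card else 0

/-- The partition function of the Gibbs distribution. -/
noncomputable def gibbsPartition (l : List (Request m)) : ℝ :=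
  ∑ Z, gibbsWeight l Z

theorem gibbsBase_nonneg (m : ℕ) : 0 ≤ gibbsBase m := sq_nonneg _

theorem gibbsBase_pos (hm : 1 ≤ m) : 0 < gibbsBase m := by
  have : (0 : ℝ) < m := by exact_mod_cast hm
  unfold gibbsBase
  positivity

theorem gibbsWeight_nonneg (l : List (Request m)) (Z : Finset (Fin m)) : 0 ≤ gibbsWeight l Z := by
  unfold gibbsWeight
  split_ifs
  · exact pow_nonneg (gibbsBase_nonneg m) _
  · exact le_rfl

theorem gibbsWeight_le (l : List (Request m)) (Z : Finset (Fin m)) :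
    gibbsWeight l Z ≤ gibbsBase m ^ Z.card := by
  unfold gibbsWeight
  split_ifs
  · exact le_rfl
  · exact pow_nonneg (gibbsBase_nonneg m) _

theorem gibbsWeight_append (l : List (Request m)) (r : Request m) (Z : Finset (Fin m))
    [Decidable (r.SatisfiedBy Z)] :
    gibbsWeight (l ++ [r]) Z = if r.SatisfiedBy Z then gibbsWeight l Z else 0 := by
  have h : (∀ r' ∈ l ++ [r], r'.SatisfiedBy Z) ↔ (∀ r' ∈ l, r'.SatisfiedBy Z) ∧ r.SatisfiedBy Z := by
    simp [or_imp, forall_and]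
  unfold gibbsWeight
  split_ifs <;> tauto

theorem pow_le_gibbsPartition {l : List (Request m)} {z : Finset (Fin m)}
    (hz : ∀ r ∈ l, r.SatisfiedBy z) : gibbsBase m ^ z.card ≤ gibbsPartition l := by
  have : gibbsWeight l z = gibbsBase m ^ z.card := if_pos hz
  rw [← this]
  exact Finset.single_le_sum (fun Z _ => gibbsWeight_nonneg l Z) (Finset.mem_univ z)

theorem gibbsPartition_pos (hm : 1 ≤ m) (l : List (Request m)) : 0 < gibbsPartition l :=
  (pow_pos (gibbsBase_pos hm) _).trans_le
    (pow_le_gibbsPartition (z := Finset.univ) fun r _ => r.satisfiedBy_univ)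

theorem sum_pow_card (x : ℝ) : ∑ Z : Finset (Fin m), x ^ Z.card = (x + 1) ^ m := by
  have := Fintype.sum_pow_mul_eq_add_pow (Fin m) x 1
  simpa using this

theorem log_gibbsPartition_nil_le (hm : 1 ≤ m) :
    Real.log (gibbsPartition ([] : List (Request m))) ≤ 1 := by
  have hm' : (1 : ℝ) ≤ m := by exact_mod_cast hm
  have : gibbsPartition ([] : List (Request m)) = (gibbsBase m + 1) ^ m := by
    simp [gibbsPartition, gibbsWeight, sum_pow_card]
  rw [this, Real.log_pow]
  have h1 : Real.log (gibbsBase m + 1) ≤ gibbsBase m := by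
    have := Real.log_le_sub_one_of_pos (add_pos (gibbsBase_pos hm) one_pos)
    linarith
  calc (m : ℝ) * Real.log (gibbsBase m + 1) ≤ m * gibbsBase m := by gcongr
    _ = 1 / (4 * m) := by unfold gibbsBase; field_simp; norm_num
    _ ≤ 1 := by rw [div_le_one (by positivity)]; linarith

/-- The single term of `z` bounds the partition function from below. Together with the bound for the
empty list, this limits the total drop of its logarithm, hence the total failure probability. -/
theorem neg_log_gibbsPartition_le (hm : 1 ≤ m) {l : List (Request m)} {z : Finset (Fin m)}
    (hz : ∀ r ∈ l, r.SatisfiedBy z) :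
    -Real.log (gibbsPartition l) ≤ 2 * Real.log (2 * m) * z.card := by
  have h := Real.log_le_log (pow_pos (gibbsBase_pos hm) _) (pow_le_gibbsPartition hz)
  rw [Real.log_pow, gibbsBase, Real.log_pow, one_div, Real.log_inv] at h
  push_cast at h
  linarith

/-- Sizes up to `2 * z.card` are harmless. A larger size exceeds this threshold by at most `u ^
(Z.card - 2 * z.card)` with `u = 2 * m`. As the Gibbs base is `u⁻²`, half of its exponent absorbs
this factor, and what remains sums to at most `gibbsBase m ^ z.card * exp (1 / 2)`. -/
theorem sum_gibbsWeight_card_le (hm : 1 ≤ m) {l : List (Request m)} {z : Finset (Fin m)}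
    (hz : ∀ r ∈ l, r.SatisfiedBy z) :
    ∑ Z, gibbsWeight l Z * (Z.card : ℝ) ≤ (2 * z.card + 2) * gibbsPartition l := by
  have hm' : (1 : ℝ) ≤ m := by exact_mod_cast hm
  set u : ℝ := 2 * m with hu
  have hu2 : 2 ≤ u := by linarith
  have hu0 : 0 < u := by linarith
  have hw : gibbsBase m = (1 / u) ^ 2 := rfl
  have hcard : ∀ Z : Finset (Fin m), (Z.card : ℝ) ≤ 2 * z.card + u ^ Z.card * (1 / u) ^ (2 * z.card) := by
    intro Z
    rcases le_total Z.card (2 * z.card) with h | h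
    · have : (Z.card : ℝ) ≤ 2 * z.card := by exact_mod_cast h
      have h2 : 0 ≤ u ^ Z.card * (1 / u) ^ (2 * z.card) := by positivity
      linarith
    · obtain ⟨d, hd⟩ := Nat.exists_eq_add_of_le h
      have h3 : u ^ Z.card * (1 / u) ^ (2 * z.card) = u ^ d := by
        rw [hd, pow_add, mul_right_comm, ← mul_pow, mul_one_div_cancel hu0.ne', one_pow, one_mul]
      have h4 : (d : ℝ) ≤ u ^ d :=
        calc (d : ℝ) ≤ 2 ^ d := by exact_mod_cast (Nat.lt_two_pow_self).le
          _ ≤ u ^ d := by gcongr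
      rw [h3, hd]
      push_cast
      linarith
  have htail : ∑ Z, gibbsWeight l Z * (u ^ Z.card * (1 / u) ^ (2 * z.card)) ≤
      2 * gibbsPartition l := by
    calc ∑ Z, gibbsWeight l Z * (u ^ Z.card * (1 / u) ^ (2 * z.card))
        ≤ ∑ Z : Finset (Fin m), gibbsBase m ^ Z.card * (u ^ Z.card * (1 / u) ^ (2 * z.card)) := by
          refine Finset.sum_le_sum fun Z _ => mul_le_mul_of_nonneg_right (gibbsWeight_le l Z) ?_
          positivity
      _ = gibbsBase m ^ z.card * ∑ Z : Finset (Fin m), (1 / u) ^ Z.card := by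
          rw [Finset.mul_sum]
          refine Finset.sum_congr rfl fun Z _ => ?_
          have : (1 / u) ^ 2 * u = 1 / u := by field_simp
          rw [hw, ← mul_assoc, ← mul_pow, this, ← pow_mul]
          ring
      _ ≤ gibbsPartition l * 2 := by
          refine mul_le_mul (pow_le_gibbsPartition hz) ?_ (by positivity)
            (gibbsPartition_pos hm l).le
          rw [sum_pow_card]
          calc (1 / u + 1) ^ m ≤ Real.exp (1 / u) ^ m := by
                gcongr
                exact Real.add_one_le_exp _
            _ = Real.exp (1 / 2) := by
                rw [← Real.exp_nat_mul, hu]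
                congr 1
                field_simp
            _ ≤ 2 := by
                have h1 : Real.exp (1 / 2) ^ 2 = Real.exp 1 := by
                  rw [← Real.exp_nat_mul]; norm_num
                have h2 := Real.exp_one_lt_d9
                nlinarith [Real.exp_pos (1 / 2 : ℝ)]
      _ = 2 * gibbsPartition l := mul_comm _ _
  calc ∑ Z, gibbsWeight l Z * (Z.card : ℝ)
      ≤ ∑ Z, gibbsWeight l Z * (2 * z.card + u ^ Z.card * (1 / u) ^ (2 * z.card)) :=
        Finset.sum_le_sum fun Z _ => mul_le_mul_of_nonneg_left (hcard Z) (gibbsWeight_nonneg l Z)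
    _ = 2 * z.card * gibbsPartition l +
        ∑ Z, gibbsWeight l Z * (u ^ Z.card * (1 / u) ^ (2 * z.card)) := by
        simp only [mul_add, Finset.sum_add_distrib, gibbsPartition, ← Finset.sum_mul]
        ring
    _ ≤ _ := by linarith

/-- The Gibbs distribution on the sets that satisfy all the requests of the list `l`. -/
noncomputable def gibbsPMF (hm : 1 ≤ m) (l : List (Request m)) : PMF (Finset (Fin m)) :=
  PMF.ofFintype (fun Z => ENNReal.ofReal (gibbsWeight l Z / gibbsPartition l)) (by
    rw [← ENNReal.ofReal_sum_of_nonneg fun Z _ =>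
      div_nonneg (gibbsWeight_nonneg l Z) (gibbsPartition_pos hm l).le, ← Finset.sum_div]
    rw [← gibbsPartition, div_self (gibbsPartition_pos hm l).ne', ENNReal.ofReal_one])

theorem expect_gibbsPMF_card_le (hm : 1 ≤ m) {l : List (Request m)} {z : Finset (Fin m)}
    (hz : ∀ r ∈ l, r.SatisfiedBy z) :
    (expect (gibbsPMF hm l) fun Z => (Z.card : ℝ≥0∞)) ≤ ENNReal.ofReal (2 * z.card + 2) := by
  have hP := gibbsPartition_pos hm l
  simp only [← ENNReal.ofReal_natCast]
  rw [expect_ofReal (w := fun Z => gibbsWeight l Z / gibbsPartition l)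
    (fun Z => div_nonneg (gibbsWeight_nonneg l Z) hP.le) (fun Z => Nat.cast_nonneg _)
    fun Z => rfl]
  refine ENNReal.ofReal_le_ofReal ?_
  simp only [div_mul_eq_mul_div]
  rw [← Finset.sum_div, div_le_iff₀ hP]
  exact sum_gibbsWeight_card_le hm hz

open scoped Classical in
/-- The probability that a Gibbs sample fails to satisfy the next request is at most the decrease
of the logarithm of the partition function. -/
theorem expect_gibbsPMF_fail_le (hm : 1 ≤ m) (l : List (Request m)) (r : Request m) :
    (expect (gibbsPMF hm l) fun Z => ENNReal.ofReal (if r.SatisfiedBy Z then 0 else 1)) ≤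
      ENNReal.ofReal (Real.log (gibbsPartition l) - Real.log (gibbsPartition (l ++ [r]))) := by
  have hP := gibbsPartition_pos hm l
  have hP' := gibbsPartition_pos hm (l ++ [r])
  rw [expect_ofReal (w := fun Z => gibbsWeight l Z / gibbsPartition l)
    (fun Z => div_nonneg (gibbsWeight_nonneg l Z) hP.le) (fun Z => by split_ifs <;> norm_num)
    fun Z => rfl]
  refine ENNReal.ofReal_le_ofReal ?_
  have hsum : ∑ Z, gibbsWeight l Z / gibbsPartition l * (if r.SatisfiedBy Z then 0 else 1) =
      1 - gibbsPartition (l ++ [r]) / gibbsPartition l := by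
    simp only [div_mul_eq_mul_div]
    rw [← Finset.sum_div, eq_sub_iff_add_eq, ← add_div, div_eq_one_iff_eq hP.ne']
    simp only [gibbsPartition, ← Finset.sum_add_distrib]
    refine Finset.sum_congr rfl fun Z _ => ?_
    rw [gibbsWeight_append]
    split_ifs <;> simp
  rw [hsum]
  -- The failure probability is `1 - x` for the ratio `x` of the partition functions, and `1 - x ≤
  -- -log x`.
  have := Real.log_le_sub_one_of_pos (div_pos hP' hP)
  rw [Real.log_div hP'.ne' hP.ne'] at this
  linarith

theorem gibbsPartition_append_le (l : List (Request m)) (r : Request m) :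
    gibbsPartition (l ++ [r]) ≤ gibbsPartition l := by
  classical
  refine Finset.sum_le_sum fun Z _ => ?_
  rw [gibbsWeight_append]
  split_ifs
  · exact le_rfl
  · exact gibbsWeight_nonneg l Z

end Gibbs

/-! ### Multiplicative updates: levels and inclusion probabilities. -/

section Levels

/-- The sets whose level is maximal. -/
def fullSets (x : Fin m → ℕ) : Finset (Fin m) :=
  Finset.univ.filter fun i => Nat.clog 2 m ≤ x i

/-- The inclusion probability of a set at level `x i`; it doubles from level to level. -/
noncomputable def levelProb (x : Fin m → ℕ) (i : Fin m) : ℝ :=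
  2 ^ x i / 2 ^ Nat.clog 2 m

/-- The levels `x` do not cover the request well enough in expectation. -/
def Underserved (x : Fin m → ℕ) (r : Request m) : Prop :=
  ∑ i ∈ r.row \ fullSets x, levelProb x i < 2 * (r.deficit (fullSets x) : ℝ)

open scoped Classical in
/-- The sets in the row of an underserved request move up by one level. -/
noncomputable def raiseLevels (x : Fin m → ℕ) (r : Request m) (i : Fin m) : ℕ :=
  if Underserved x r ∧ i ∈ r.row \ fullSets x then x i + 1 else x i

/-- The levels after the requests of the list. -/
noncomputable def level (l : List (Request m)) : Fin m → ℕ :=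
  l.foldl raiseLevels fun _ => 0

theorem level_append (l : List (Request m)) (r : Request m) :
    level (l ++ [r]) = raiseLevels (level l) r := by
  simp [level]

theorem le_raiseLevels (x : Fin m → ℕ) (r : Request m) (i : Fin m) : x i ≤ raiseLevels x r i := by
  unfold raiseLevels
  split_ifs <;> omega

theorem level_le (l : List (Request m)) (i : Fin m) : level l i ≤ Nat.clog 2 m := by
  induction l using List.reverseRecOn with
  | nil => simp [level]
  | append_singleton l r ih =>
    rw [level_append, raiseLevels]
    split_ifs with h
    · have := (Finset.mem_sdiff.1 h.2).2
      simp only [fullSets, Finset.mem_filter, Finset.mem_univ, true_and, not_le] at this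
      omega
    · exact ih

theorem levelProb_nonneg (x : Fin m → ℕ) (i : Fin m) : 0 ≤ levelProb x i := by
  unfold levelProb
  positivity

theorem levelProb_level_le_one (l : List (Request m)) (i : Fin m) :
    levelProb (level l) i ≤ 1 := by
  unfold levelProb
  rw [div_le_one (by positivity)]
  exact pow_le_pow_right₀ one_le_two (level_le l i)

theorem levelProb_eq_one {l : List (Request m)} {i : Fin m} (hi : i ∈ fullSets (level l)) :
    levelProb (level l) i = 1 := by
  have h : level l i = Nat.clog 2 m := le_antisymm (level_le l i) (Finset.mem_filter.1 hi).2
  rw [levelProb, h, div_self (by positivity)]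

/-- Raising the levels for an underserved request raises the levels within any solution of that
request by at least its residual demand. -/
theorem sum_raiseLevels_ge {x : Fin m → ℕ} {r : Request m} (h : Underserved x r)
    {z : Finset (Fin m)} (hz : r.SatisfiedBy z) :
    ∑ i ∈ z, x i + r.deficit (fullSets x) ≤ ∑ i ∈ z, raiseLevels x r i := by
  have hsum : ∑ i ∈ z, raiseLevels x r i = ∑ i ∈ z, x i + (z ∩ (r.row \ fullSets x)).card := by
    have : ∀ i, raiseLevels x r i = x i + if i ∈ r.row \ fullSets x then 1 else 0 := by
      intro i
      by_cases hi : i ∈ r.row \ fullSets x <;> simp only [raiseLevels, h, hi, true_and, if_true,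
        if_false, add_zero]
    simp only [this, Finset.sum_add_distrib, Finset.sum_ite_mem, Finset.sum_const, smul_eq_mul,
      mul_one]
  -- What `z` uses beyond the full sets is exactly what gets raised, so at least the residual demand
  -- of raised sets lies in `z`.
  have hsub : r.row ∩ z ⊆ (z ∩ (r.row \ fullSets x)) ∪ (r.row ∩ fullSets x) := by
    intro i hi
    simp only [Finset.mem_union, Finset.mem_inter, Finset.mem_sdiff] at hi ⊢
    tauto
  have h1 := (Finset.card_le_card hsub).trans (Finset.card_union_le _ _)
  unfold Request.SatisfiedBy at hz
  unfold Request.deficit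
  omega

/-- Doubling adds the old probability of each raised set, and these add up to less than twice the
deficit because the request is underserved. -/
theorem sum_levelProb_raiseLevels_le {x : Fin m → ℕ} {r : Request m} (h : Underserved x r) :
    ∑ i, levelProb (raiseLevels x r) i ≤ ∑ i, levelProb x i + 2 * (r.deficit (fullSets x) : ℝ) := by
  have : ∀ i, levelProb (raiseLevels x r) i =
      levelProb x i + if i ∈ r.row \ fullSets x then levelProb x i else 0 := by
    intro i
    by_cases hi : i ∈ r.row \ fullSets x
    · simp only [raiseLevels, levelProb, h, hi, true_and, if_true]
      ring
    · simp only [raiseLevels, levelProb, hi, and_false, if_false, add_zero]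
  simp only [this, Finset.sum_add_distrib, Finset.sum_ite_mem, Finset.univ_inter]
  unfold Underserved at h
  linarith

theorem raiseLevels_of_not_underserved {x : Fin m → ℕ} {r : Request m} (h : ¬Underserved x r) :
    raiseLevels x r = x := by
  ext i
  simp [raiseLevels, h]

/-- The initial probabilities are at most `1 / m` each, so they sum to at most one. Each update adds
at most twice the deficit to the total probability and at least the deficit to the levels inside
`z`. -/
theorem sum_levelProb_level_le {l : List (Request m)} {z : Finset (Fin m)}
    (hz : ∀ r ∈ l, r.SatisfiedBy z) :
    ∑ i, levelProb (level l) i ≤ 1 + 2 * ∑ i ∈ z, (level l i : ℝ) := by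
  induction l using List.reverseRecOn with
  | nil =>
    have h : (m : ℝ) ≤ 2 ^ Nat.clog 2 m := by exact_mod_cast Nat.le_pow_clog one_lt_two m
    simp only [level, levelProb, List.foldl_nil, pow_zero, Finset.sum_const, Finset.card_univ,
      Fintype.card_fin, nsmul_eq_mul, Nat.cast_zero, mul_zero, add_zero]
    rw [mul_one_div, div_le_one (by positivity)]
    exact h
  | append_singleton l r ih =>
    have ih' := ih fun r' hr' => hz r' (by simp [hr'])
    rw [level_append]
    by_cases h : Underserved (level l) r
    · have h1 := sum_levelProb_raiseLevels_le h
      have h2 := sum_raiseLevels_ge h (hz r (by simp))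
      have h3 : ∑ i ∈ z, (level l i : ℝ) + (r.deficit (fullSets (level l)) : ℝ) ≤
          ∑ i ∈ z, (raiseLevels (level l) r i : ℝ) := by exact_mod_cast h2
      linarith
    · rw [raiseLevels_of_not_underserved h]
      exact ih'

end Levels

/-! ### The learner, its size and its total loss. -/

section Learner

/-- The Bernoulli part of the learner. -/
noncomputable def levelPMF (l : List (Request m)) : PMF (Finset (Fin m)) :=
  bernoulliPMF (levelProb (level l)) (levelProb_nonneg _) (levelProb_level_le_one l)

open scoped Classical in
/-- The random solution proposed after the requests of the list `l`. -/
noncomputable def learner (hm : 1 ≤ m) (l : List (Request m)) : PMF (Finset (Fin m)) :=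
  -- The size bounds of both parts have additive constants, which an optimum of zero could not pay;
  -- nothing is proposed until some demand is positive.
  if ∀ r ∈ l, r.demand = 0 then PMF.pure ∅
  else (levelPMF l).bind fun Y => (gibbsPMF hm l).map fun Z => Y ∪ Z

/-- The expected deficit of a request after the requests of the list `l`. -/
noncomputable def learnerLoss (hm : 1 ≤ m) (l : List (Request m)) (r : Request m) : ℝ≥0∞ :=
  expect (learner hm l) fun X => (r.deficit X : ℝ≥0∞)

/-- The competitive ratio of the learner. -/
noncomputable def learnerRatio (m : ℕ) : ℝ :=
  2 * Nat.clog 2 m + 2 * Real.log (2 * m) + 5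

theorem expect_levelPMF_card (l : List (Request m)) :
    (expect (levelPMF l) fun Y => (Y.card : ℝ≥0∞)) =
      ENNReal.ofReal (∑ i, levelProb (level l) i) := by
  simp only [← ENNReal.ofReal_natCast]
  rw [expect_ofReal (bernoulliWeight_nonneg (levelProb_nonneg _) (levelProb_level_le_one l))
    (fun Y => Nat.cast_nonneg _) fun Y => rfl, sum_bernoulliWeight_card]

theorem expect_levelPMF_deficit_le_one {l : List (Request m)} {r : Request m}
    (h : ¬Underserved (level l) r) :
    (expect (levelPMF l) fun Y => (r.deficit Y : ℝ≥0∞)) ≤ 1 := by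
  simp only [← ENNReal.ofReal_natCast]
  rw [expect_ofReal (bernoulliWeight_nonneg (levelProb_nonneg _) (levelProb_level_le_one l))
    (fun Y => Nat.cast_nonneg _) fun Y => rfl, ← ENNReal.ofReal_one]
  refine ENNReal.ofReal_le_ofReal ?_
  exact sum_bernoulliWeight_deficit_le_one (levelProb_nonneg _) (levelProb_level_le_one l) r
    (fullSets (level l)) (fun i hi => levelProb_eq_one hi) (not_lt.1 h)

theorem fullSets_subset_of_mem_support {l : List (Request m)} {Y : Finset (Fin m)}
    (hY : Y ∈ (levelPMF l).support) : fullSets (level l) ⊆ Y := by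
  intro i hi
  by_contra hiY
  refine (PMF.mem_support_iff _ _).1 hY ?_
  change ENNReal.ofReal (bernoulliWeight _ Y) = 0
  rw [bernoulliWeight_eq_zero (levelProb_eq_one hi) hiY, ENNReal.ofReal_zero]

theorem learner_card_le (hm : 1 ≤ m) {l : List (Request m)} {z : Finset (Fin m)}
    (hz : ∀ r ∈ l, r.SatisfiedBy z) :
    (expect (learner hm l) fun X => (X.card : ℝ≥0∞)) ≤
      ENNReal.ofReal (learnerRatio m) * z.card := by
  have hlog : 0 ≤ Real.log (2 * m) := by
    refine Real.log_nonneg ?_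
    have : (1 : ℝ) ≤ m := by exact_mod_cast hm
    linarith
  unfold learner
  split_ifs with h0
  · simp [expect_pure]
  · push Not at h0
    obtain ⟨r, hr, hr0⟩ := h0
    -- A positive demand forces `z` to be nonempty, so the additive constants `1` and `2` below are
    -- absorbed into the `5` of `learnerRatio`.
    have hz1 : (1 : ℝ) ≤ z.card := by
      have := (hz r hr).demand_le_card
      exact_mod_cast (Nat.one_le_iff_ne_zero.2 hr0).trans this
    have hlev : ∑ i ∈ z, (level l i : ℝ) ≤ z.card * Nat.clog 2 m := by
      rw [← nsmul_eq_mul]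
      exact Finset.sum_le_card_nsmul _ _ _ fun i _ => by exact_mod_cast level_le l i
    simp only [expect_bind, expect_map]
    calc (expect (levelPMF l) fun Y => expect (gibbsPMF hm l) fun Z => ((Y ∪ Z).card : ℝ≥0∞))
        ≤ expect (levelPMF l) fun Y => expect (gibbsPMF hm l) fun Z =>
            ((Y.card : ℝ≥0∞) + (Z.card : ℝ≥0∞)) :=
          expect_mono _ fun Y => expect_mono _ fun Z => by exact_mod_cast Finset.card_union_le Y Z
      _ = (expect (levelPMF l) fun Y => (Y.card : ℝ≥0∞)) +
            expect (gibbsPMF hm l) fun Z => (Z.card : ℝ≥0∞) := by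
          simp only [expect_add, expect_const]
      _ ≤ ENNReal.ofReal (1 + 2 * ∑ i ∈ z, (level l i : ℝ)) + ENNReal.ofReal (2 * z.card + 2) := by
          rw [expect_levelPMF_card]
          exact add_le_add (ENNReal.ofReal_le_ofReal (sum_levelProb_level_le hz))
            (expect_gibbsPMF_card_le hm hz)
      _ = ENNReal.ofReal (1 + 2 * ∑ i ∈ z, (level l i : ℝ) + (2 * z.card + 2)) := by
          rw [← ENNReal.ofReal_add (by positivity) (by positivity)]
      _ ≤ ENNReal.ofReal (learnerRatio m * z.card) := by
          refine ENNReal.ofReal_le_ofReal ?_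
          unfold learnerRatio
          nlinarith
      _ = _ := by
          rw [ENNReal.ofReal_mul' (Nat.cast_nonneg _), ENNReal.ofReal_natCast]

open scoped Classical in
/-- The potential of the learner with respect to the solution `z`. -/
noncomputable def learnerPotential (z : Finset (Fin m)) (l : List (Request m)) : ℝ :=
  ∑ i ∈ z, (level l i : ℝ) +
    (Real.log (gibbsPartition ([] : List (Request m))) - Real.log (gibbsPartition l)) +
    if ∀ r ∈ l, r.demand = 0 then 0 else (z.card : ℝ)

theorem learnerPotential_nil (z : Finset (Fin m)) : learnerPotential z [] = 0 := by
  simp [learnerPotential, level]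

theorem learnerPotential_le (hm : 1 ≤ m) {l : List (Request m)} {z : Finset (Fin m)}
    (hz : ∀ r ∈ l, r.SatisfiedBy z) :
    learnerPotential z l ≤ (Nat.clog 2 m + 2 * Real.log (2 * m) + 1) * z.card + 1 := by
  have hlev : ∑ i ∈ z, (level l i : ℝ) ≤ z.card * Nat.clog 2 m := by
    rw [← nsmul_eq_mul]
    exact Finset.sum_le_card_nsmul _ _ _ fun i _ => by exact_mod_cast level_le l i
  have h1 := log_gibbsPartition_nil_le hm
  have h2 := neg_log_gibbsPartition_le hm hz
  have h3 : (0 : ℝ) ≤ z.card := Nat.cast_nonneg _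
  unfold learnerPotential
  split_ifs <;> nlinarith

/-- The expected deficit of the next request is at most the increase of the potential. -/
theorem learnerLoss_le (hm : 1 ≤ m) {l : List (Request m)} {r : Request m} {z : Finset (Fin m)}
    (hr : r.SatisfiedBy z) :
    0 ≤ learnerPotential z (l ++ [r]) - learnerPotential z l ∧
    learnerLoss hm l r ≤
      ENNReal.ofReal (learnerPotential z (l ++ [r]) - learnerPotential z l) := by
  classical
  have hP' := gibbsPartition_pos hm (l ++ [r])
  have hpart := Real.log_le_log hP' (gibbsPartition_append_le l r)
  have hmono : ∑ i ∈ z, (level l i : ℝ) ≤ ∑ i ∈ z, (level (l ++ [r]) i : ℝ) := by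
    refine Finset.sum_le_sum fun i _ => ?_
    rw [level_append]
    exact_mod_cast le_raiseLevels _ _ _
  have hz0 : (0 : ℝ) ≤ z.card := Nat.cast_nonneg _
  have happ : (∀ r' ∈ l ++ [r], r'.demand = 0) ↔ (∀ r' ∈ l, r'.demand = 0) ∧ r.demand = 0 := by
    simp [or_imp, forall_and]
  have hite : (if ∀ r' ∈ l, r'.demand = 0 then 0 else (z.card : ℝ)) ≤
      if ∀ r' ∈ l ++ [r], r'.demand = 0 then 0 else (z.card : ℝ) := by
    split_ifs <;> first | exact le_rfl | exact hz0 | tauto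
  refine ⟨by unfold learnerPotential; linarith, ?_⟩
  unfold learnerLoss learner
  by_cases h0 : ∀ r' ∈ l, r'.demand = 0
  · rw [if_pos h0, expect_pure, ← ENNReal.ofReal_natCast]
    refine ENNReal.ofReal_le_ofReal ?_
    -- While the proposal is empty, only the first positive demand is lost; the last term of the
    -- potential switches on then and pays for it.
    have hd : (r.deficit ∅ : ℝ) ≤
        (if ∀ r' ∈ l ++ [r], r'.demand = 0 then 0 else (z.card : ℝ)) -
        if ∀ r' ∈ l, r'.demand = 0 then 0 else (z.card : ℝ) := by
      rw [if_pos h0, sub_zero]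
      have h1 := r.deficit_le_demand ∅
      split_ifs with h2
      · have := (happ.1 h2).2
        exact_mod_cast this ▸ h1
      · exact_mod_cast h1.trans hr.demand_le_card
    unfold learnerPotential
    linarith
  · rw [if_neg h0]
    simp only [expect_bind, expect_map]
    set fail : Finset (Fin m) → ℝ≥0∞ := fun Z => ENNReal.ofReal (if r.SatisfiedBy Z then 0 else 1)
      with hfail
    -- As `Y` and `Z` are independent, this pointwise product bound becomes a product of
    -- expectations.
    have hdef : ∀ Y Z, (r.deficit (Y ∪ Z) : ℝ≥0∞) ≤ r.deficit Y * fail Z := by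
      intro Y Z
      simp only [hfail]
      split_ifs with h
      · rw [Request.deficit_eq_zero_iff.2 (h.mono Finset.subset_union_right)]
        simp
      · rw [ENNReal.ofReal_one, mul_one]
        exact_mod_cast r.deficit_anti Finset.subset_union_left
    calc (expect (levelPMF l) fun Y => expect (gibbsPMF hm l) fun Z => (r.deficit (Y ∪ Z) : ℝ≥0∞))
        ≤ expect (levelPMF l) fun Y => expect (gibbsPMF hm l) fun Z => r.deficit Y * fail Z :=
          expect_mono _ fun Y => expect_mono _ fun Z => hdef Y Z
      _ = (expect (levelPMF l) fun Y => (r.deficit Y : ℝ≥0∞)) * expect (gibbsPMF hm l) fail := by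
          simp only [expect_mul_left, expect_mul_right]
      _ ≤ _ := ?_
    -- An underserved request is paid by the level term of the potential, any other request by the
    -- partition function term.
    by_cases hu : Underserved (level l) r
    · have h1 : (expect (levelPMF l) fun Y => (r.deficit Y : ℝ≥0∞)) ≤
          ENNReal.ofReal (r.deficit (fullSets (level l)) : ℝ) := by
        rw [ENNReal.ofReal_natCast, ← expect_const (levelPMF l)
          (r.deficit (fullSets (level l)) : ℝ≥0∞)]
        refine expect_mono_support _ fun Y hY => ?_
        exact_mod_cast r.deficit_anti (fullSets_subset_of_mem_support hY)
      have h2 : expect (gibbsPMF hm l) fail ≤ 1 := by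
        rw [← expect_const (gibbsPMF hm l) 1]
        refine expect_mono _ fun Z => ?_
        simp only [hfail]
        split_ifs <;> simp
      refine (mul_le_mul' h1 h2).trans ?_
      rw [mul_one]
      refine ENNReal.ofReal_le_ofReal ?_
      have h3 : ∑ i ∈ z, (level l i : ℝ) + (r.deficit (fullSets (level l)) : ℝ) ≤
          ∑ i ∈ z, (level (l ++ [r]) i : ℝ) := by
        rw [level_append]
        exact_mod_cast sum_raiseLevels_ge hu hr
      unfold learnerPotential
      linarith
    · refine (mul_le_mul' (expect_levelPMF_deficit_le_one hu)
        (expect_gibbsPMF_fail_le hm l r)).trans ?_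
      rw [one_mul]
      refine ENNReal.ofReal_le_ofReal ?_
      unfold learnerPotential
      linarith

/-- The first `j` requests of the sequence `v`. -/
def pre {N : ℕ} (v : Fin N → Request m) (j : ℕ) : List (Request m) :=
  (List.ofFn v).take j

theorem pre_succ {N : ℕ} (v : Fin N → Request m) {j : ℕ} (hj : j < N) :
    pre v (j + 1) = pre v j ++ [v ⟨j, hj⟩] := by
  unfold pre
  rw [List.take_succ_eq_append_getElem (by simpa using hj)]
  simp

theorem mem_pre {N : ℕ} {v : Fin N → Request m} {j : ℕ} {r : Request m} (h : r ∈ pre v j) :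
    ∃ i, v i = r := by
  simpa using List.mem_of_mem_take h

theorem sum_learnerLoss_le_potential (hm : 1 ≤ m) {N : ℕ} (v : Fin N → Request m)
    {z : Finset (Fin m)} (hz : ∀ i, (v i).SatisfiedBy z) {h : ℕ} (hN : h ≤ N) :
    0 ≤ learnerPotential z (pre v h) ∧
    ∑ j : Fin h, learnerLoss hm (pre v j) (v (Fin.castLE hN j)) ≤
      ENNReal.ofReal (learnerPotential z (pre v h)) := by
  induction h with
  | zero => simp [pre, learnerPotential_nil]
  | succ h ih =>
    obtain ⟨ih1, ih2⟩ := ih (Nat.le_of_succ_le hN)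
    obtain ⟨h1, h2⟩ := learnerLoss_le hm (l := pre v h) (hz ⟨h, hN⟩)
    rw [pre_succ v hN]
    refine ⟨by linarith, ?_⟩
    rw [Fin.sum_univ_castSucc]
    refine (add_le_add ih2 h2).trans ?_
    rw [← ENNReal.ofReal_add ih1 h1]
    exact ENNReal.ofReal_le_ofReal (by linarith)

/-- The learner suffers a total expected deficit of at most its ratio times any solution. -/
theorem sum_learnerLoss_le (hm : 1 ≤ m) {N : ℕ} (v : Fin N → Request m)
    {z : Finset (Fin m)} (hz : ∀ i, (v i).SatisfiedBy z) {h : ℕ} (hN : h ≤ N) :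
    ∑ j : Fin h, learnerLoss hm (pre v j) (v (Fin.castLE hN j)) ≤
      ENNReal.ofReal (learnerRatio m) * z.card := by
  -- The potential bound has an additive `1`. For empty `z` all demands vanish and so do the losses.
  rcases Nat.eq_zero_or_pos z.card with h0 | h0
  · refine le_of_eq_of_le (Finset.sum_eq_zero fun j _ => ?_) zero_le
    have hd : ∀ X, (v (Fin.castLE hN j)).deficit X = 0 := fun X =>
      Nat.le_zero.1 ((Request.deficit_le_demand _ X).trans
        (h0 ▸ (hz (Fin.castLE hN j)).demand_le_card))
    simp [learnerLoss, hd, expect]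
  · refine (sum_learnerLoss_le_potential hm v hz hN).2.trans ?_
    rw [← ENNReal.ofReal_natCast, ← ENNReal.ofReal_mul' (Nat.cast_nonneg _)]
    refine ENNReal.ofReal_le_ofReal ((learnerPotential_le hm (l := pre v h) ?_).trans ?_)
    · intro r hr
      obtain ⟨i, rfl⟩ := mem_pre hr
      exact hz i
    · have hz1 : (1 : ℝ) ≤ z.card := by exact_mod_cast h0
      have : (0 : ℝ) ≤ (Nat.clog 2 m : ℝ) * z.card := by positivity
      unfold learnerRatio
      nlinarith

/-- With `L = log (m * n) ≥ log 2`, one has `log (2 * m) ≤ 2 * L` and `clog 2 m * log 2 ≤ log (2 *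
m)`, so the ratio is at most `(9 / log 2 + 4) * L`, below `18 * L`. -/
theorem learnerRatio_le {n : ℕ} (hmn : 2 ≤ m * n) :
    learnerRatio m ≤ 18 * Real.log (m * n) := by
  have hm : 1 ≤ m := Nat.pos_of_ne_zero (by rintro rfl; simp at hmn)
  have hn : 1 ≤ n := Nat.pos_of_ne_zero (by rintro rfl; simp at hmn)
  have hm' : (1 : ℝ) ≤ m := by exact_mod_cast hm
  have hn' : (1 : ℝ) ≤ n := by exact_mod_cast hn
  have hmn' : (2 : ℝ) ≤ m * n := by exact_mod_cast hmn
  have hlog2 := Real.log_two_gt_d9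
  have hA : Real.log 2 ≤ Real.log (m * n) := Real.log_le_log two_pos hmn'
  have hB : Real.log m ≤ Real.log (m * n) :=
    Real.log_le_log (by linarith) (by nlinarith)
  have hC : Real.log (2 * m) = Real.log 2 + Real.log m :=
    Real.log_mul two_ne_zero (by linarith)
  have hD : (Nat.clog 2 m : ℝ) * Real.log 2 ≤ Real.log (2 * m) := by
    rcases hm.eq_or_lt with rfl | hm1
    · simp [Real.log_nonneg]
    · have h1 := Nat.pow_pred_clog_lt_self one_lt_two hm1
      have h2 : 2 ^ Nat.clog 2 m ≤ 2 * m := by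
        have h3 : Nat.clog 2 m = (Nat.clog 2 m).pred + 1 :=
          (Nat.succ_pred_eq_of_pos (Nat.clog_pos one_lt_two hm1)).symm
        rw [h3, pow_succ]
        omega
      rw [← Real.log_pow]
      refine Real.log_le_log (by positivity) ?_
      exact_mod_cast h2
  unfold learnerRatio
  nlinarith

end Learner

/-! ### The learner on requests in random order. -/

section RandomOrder

theorem pre_congr {N : ℕ} {v v' : Fin N → Request m} {j : ℕ}
    (h : ∀ i : Fin N, (i : ℕ) < j → v i = v' i) : pre v j = pre v' j := by
  refine List.ext_getElem (by simp [pre]) fun i hi hi' => ?_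
  simp only [pre, List.length_take, List.length_ofFn, lt_min_iff] at hi
  simpa [pre] using h ⟨i, hi.2⟩ hi.1

variable {ι : Type} [Fintype ι] [DecidableEq ι] {N : ℕ}

/-- In random order every request that is still to come is distributed as the next one. -/
theorem sum_learnerLoss_exchange (hm : 1 ≤ m) (v : ι → Request m) {j q : Fin N} (hjq : j ≤ q) :
    ∑ e : Fin N ≃ ι, learnerLoss hm (pre (v ∘ e) j) (v (e q)) =
      ∑ e : Fin N ≃ ι, learnerLoss hm (pre (v ∘ e) j) (v (e j)) := by
  -- Swapping the positions `j ≤ q` leaves the first `j` requests untouched and preserves the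
  -- uniform order.
  rw [← (Equiv.equivCongr (Equiv.swap j q) (Equiv.refl ι)).sum_comp]
  refine Finset.sum_congr rfl fun e _ => ?_
  congr 1
  · refine pre_congr fun i hi => ?_
    have h1 : i ≠ j := fun h => by simp [h] at hi
    have h2 : i ≠ q := fun h => by
      rw [h] at hi
      exact absurd hjq (not_le.2 hi)
    simp [Equiv.equivCongr, Equiv.swap_apply_of_ne_of_ne h1 h2]
  · simp [Equiv.equivCongr]

/-- By exchangeability each of the at most `N` remaining requests loses as much as the next one, and
the losses of the next requests sum to at most the learner's bound. -/
theorem sum_learnerLoss_remaining_le (hm : 1 ≤ m) [Nonempty (Fin N ≃ ι)] (v : ι → Request m)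
    {z : Finset (Fin m)} (hz : ∀ i, (v i).SatisfiedBy z) {h : ℕ} (hN : h ≤ N) :
    ∑ j : Fin h, ∑ q : Fin N with Fin.castLE hN j ≤ q,
      (expect (PMF.uniformOfFintype (Fin N ≃ ι)) fun e =>
        learnerLoss hm (pre (v ∘ e) j) (v (e q))) ≤
      N * (ENNReal.ofReal (learnerRatio m) * z.card) := by
  have hterm : ∀ j : Fin h, ∑ q : Fin N with Fin.castLE hN j ≤ q,
      (expect (PMF.uniformOfFintype (Fin N ≃ ι)) fun e =>
        learnerLoss hm (pre (v ∘ e) j) (v (e q))) ≤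
      N * expect (PMF.uniformOfFintype (Fin N ≃ ι)) fun e =>
        learnerLoss hm (pre (v ∘ e) j) (v (e (Fin.castLE hN j))) := by
    intro j
    have hq : ∀ q ∈ Finset.univ.filter fun q : Fin N => Fin.castLE hN j ≤ q,
        (expect (PMF.uniformOfFintype (Fin N ≃ ι)) fun e =>
          learnerLoss hm (pre (v ∘ e) j) (v (e q))) =
        expect (PMF.uniformOfFintype (Fin N ≃ ι)) fun e =>
          learnerLoss hm (pre (v ∘ e) j) (v (e (Fin.castLE hN j))) := by
      intro q hq
      rw [expect_uniformOfFintype, expect_uniformOfFintype]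
      congr 1
      exact sum_learnerLoss_exchange hm v (Finset.mem_filter.1 hq).2
    rw [Finset.sum_congr rfl hq, Finset.sum_const, nsmul_eq_mul]
    refine mul_le_mul_left ?_ _
    have := Finset.card_le_univ (Finset.univ.filter fun q : Fin N => Fin.castLE hN j ≤ q)
    rw [Fintype.card_fin] at this
    exact_mod_cast this
  refine (Finset.sum_le_sum fun j _ => hterm j).trans ?_
  rw [← Finset.mul_sum, ← expect_sum]
  refine mul_le_mul_right ?_ _
  rw [← expect_const (PMF.uniformOfFintype (Fin N ≃ ι)) (ENNReal.ofReal (learnerRatio m) * z.card)]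
  exact expect_mono _ fun e => sum_learnerLoss_le hm (v ∘ e) (fun i => hz (e i)) hN

end RandomOrder

/-! ### Minimal purchases that complete a solution. -/

section TopUp

theorem exists_topUp (z : Finset (Fin m)) (r : Request m) :
    ∃ t ⊆ r.row \ z, t.card = r.deficit z := by
  refine Finset.exists_subset_card_eq ?_
  have h1 := Finset.card_sdiff_add_card_inter r.row z
  have h2 := r.satisfiable
  unfold Request.deficit
  omega

/-- A smallest set of purchases that satisfies the request, given the solution `z`. -/
noncomputable def topUp (z : Finset (Fin m)) (r : Request m) : Finset (Fin m) :=
  (exists_topUp z r).choose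

theorem card_topUp (z : Finset (Fin m)) (r : Request m) : (topUp z r).card = r.deficit z :=
  (exists_topUp z r).choose_spec.2

theorem satisfiedBy_union_topUp (z : Finset (Fin m)) (r : Request m) :
    r.SatisfiedBy (z ∪ topUp z r) := by
  have hsub : topUp z r ⊆ r.row \ z := (exists_topUp z r).choose_spec.1
  have hcard := card_topUp z r
  have hdisj : Disjoint (r.row ∩ z) (topUp z r) :=
    (Finset.disjoint_sdiff_inter r.row z).symm.mono_right hsub
  have hle : (r.row ∩ z) ∪ topUp z r ⊆ r.row ∩ (z ∪ topUp z r) := by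
    intro i hi
    rcases Finset.mem_union.1 hi with hi | hi
    · simp only [Finset.mem_inter, Finset.mem_union] at hi ⊢
      tauto
    · exact Finset.mem_inter.2 ⟨(Finset.mem_sdiff.1 (hsub hi)).1, Finset.mem_union_right _ hi⟩
  have := Finset.card_le_card hle
  rw [Finset.card_union_of_disjoint hdisj] at this
  unfold Request.SatisfiedBy
  unfold Request.deficit at hcard
  omega

/-- The union of the purchases for all the requests of the list. -/
noncomputable def topUps (z : Finset (Fin m)) : List (Request m) → Finset (Fin m)
  | [] => ∅
  | r :: l => topUp z r ∪ topUps z l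

theorem topUp_subset_topUps {z : Finset (Fin m)} {r : Request m} {l : List (Request m)}
    (h : r ∈ l) : topUp z r ⊆ topUps z l := by
  induction l with
  | nil => simp at h
  | cons r' l ih =>
    rcases List.mem_cons.1 h with rfl | h
    · exact Finset.subset_union_left
    · exact (ih h).trans Finset.subset_union_right

theorem card_topUps_le (z : Finset (Fin m)) (l : List (Request m)) :
    (topUps z l).card ≤ (l.map fun r => r.deficit z).sum := by
  induction l with
  | nil => simp [topUps]
  | cons r l ih =>
    rw [List.map_cons, List.sum_cons, ← card_topUp z r]
    exact (Finset.card_union_le _ _).trans (by omega)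

end TopUp

/-! ### Online algorithms that propose a solution and top it up. -/

section Proposal

variable {Info Seed : Type}

/-- The online algorithm that buys a random solution `X`, either before the online sequence begins
or when the first request arrives, and afterwards tops it up for each request separately. -/
noncomputable def proposalAlgorithm (law : PMF Seed) (X : Seed → Info → Finset (Fin m))
    (eager : Bool) : OnlineAlgorithm m Info where
  Seed := Seed
  law := law
  initial ω s := if eager then X ω s else ∅
  -- Top-ups ignore each other, so their cost is at most the sum of the deficits left by `X` alone.
  buy ω s l := X ω s ∪ l.getLast?.elim ∅ (topUp (X ω s))

variable (law : PMF Seed) (X : Seed → Info → Finset (Fin m)) (eager : Bool)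

theorem proposalAlgorithm_alwaysServes : (proposalAlgorithm law X eager).AlwaysServes := by
  intro ω s l l' _ r hr
  obtain ⟨j, hj, rfl⟩ := List.getElem_of_mem hr
  refine (satisfiedBy_union_topUp (X ω s) l'[j]).mono ?_
  refine Finset.Subset.trans ?_ Finset.subset_union_right
  have hbuy : X ω s ∪ topUp (X ω s) l'[j] =
      (proposalAlgorithm law X eager).buy ω s (l'.take (j + 1)) := by
    simp only [proposalAlgorithm]
    rw [List.take_succ_eq_append_getElem hj, List.getLast?_concat]
    rfl
  rw [hbuy]
  exact Finset.subset_biUnion_of_mem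
    (fun j => (proposalAlgorithm law X eager).buy ω s (l'.take (j + 1))) (Finset.mem_range.2 hj)

theorem proposalAlgorithm_online_subset (ω : Seed) (s : Info) (l : List (Request m)) :
    (proposalAlgorithm law X eager).online ω s l ⊆ X ω s ∪ topUps (X ω s) l := by
  refine Finset.biUnion_subset.2 fun j _ => ?_
  refine Finset.union_subset_union_right ?_
  cases h : (l.take (j + 1)).getLast? with
  | none => simp
  | some r =>
    exact topUp_subset_topUps (List.mem_of_mem_take (List.mem_of_getLast? h))

theorem proposalAlgorithm_held_card_le (ω : Seed) (s : Info) (l : List (Request m)) :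
    ((proposalAlgorithm law X eager).held ω s l).card ≤
      (X ω s).card + (l.map fun r => r.deficit (X ω s)).sum := by
  have h : (proposalAlgorithm law X eager).held ω s l ⊆ X ω s ∪ topUps (X ω s) l := by
    refine Finset.union_subset ?_ (proposalAlgorithm_online_subset law X eager ω s l)
    cases eager
    · simp [proposalAlgorithm]
    · simp [proposalAlgorithm]
  refine (Finset.card_le_card h).trans ((Finset.card_union_le _ _).trans ?_)
  exact Nat.add_le_add_left (card_topUps_le _ _) _

theorem proposalAlgorithm_cost_le (s : Info) (l : List (Request m)) :
    (proposalAlgorithm law X eager).cost s l ≤ expect law fun ω =>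
      ((X ω s).card : ℝ≥0∞) + ((l.map fun r => r.deficit (X ω s)).sum : ℕ) :=
  expect_mono _ fun ω => by exact_mod_cast proposalAlgorithm_held_card_le law X eager ω s l

theorem proposalAlgorithm_twoStageCost_eager_le (c : ℝ≥0∞) (s : Info) (l : List (Request m)) :
    (proposalAlgorithm law X true).twoStageCost c s l ≤ expect law fun ω =>
      ((X ω s).card : ℝ≥0∞) + c * ((l.map fun r => r.deficit (X ω s)).sum : ℕ) := by
  refine expect_mono _ fun ω => ?_
  refine add_le_add (by simp [proposalAlgorithm]) (mul_le_mul_right ?_ _)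
  have h : (proposalAlgorithm law X true).online ω s l \
      (proposalAlgorithm law X true).initial ω s ⊆ topUps (X ω s) l := by
    refine (Finset.sdiff_subset_sdiff (proposalAlgorithm_online_subset law X true ω s l)
      (Finset.Subset.refl _)).trans ?_
    intro i hi
    simp only [proposalAlgorithm, if_true, Finset.mem_sdiff, Finset.mem_union] at hi
    tauto
  exact_mod_cast (Finset.card_le_card h).trans (card_topUps_le _ _)

theorem proposalAlgorithm_twoStageCost_lazy_le (c : ℝ≥0∞) (s : Info) (l : List (Request m)) :
    (proposalAlgorithm law X false).twoStageCost c s l ≤ c * expect law fun ω =>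
      ((X ω s).card : ℝ≥0∞) + ((l.map fun r => r.deficit (X ω s)).sum : ℕ) := by
  rw [← expect_mul_left]
  refine expect_mono _ fun ω => ?_
  have h0 : (proposalAlgorithm law X false).initial ω s = ∅ := by simp [proposalAlgorithm]
  rw [h0, Finset.card_empty, Nat.cast_zero, zero_add, Finset.sdiff_empty]
  refine mul_le_mul_right ?_ _
  have h := (Finset.card_le_card (Finset.subset_union_right.trans
    (Finset.Subset.refl _))).trans (proposalAlgorithm_held_card_le law X false ω s l)
  exact_mod_cast h

end Proposal

/-! ### Attainment of the offline optimum. -/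

section Optimum

variable {ι : Type}

theorem exists_opt_eq (v : ι → Request m) :
    ∃ z : Finset (Fin m), (∀ i, (v i).SatisfiedBy z) ∧ opt v = z.card := by
  classical
  have hne : (Finset.univ.filter fun z : Finset (Fin m) => ∀ i, (v i).SatisfiedBy z).Nonempty :=
    ⟨Finset.univ, by simp [Request.satisfiedBy_univ]⟩
  obtain ⟨z, hz, hmin⟩ := Finset.exists_min_image _ Finset.card hne
  have hz' := (Finset.mem_filter.1 hz).2
  refine ⟨z, hz', le_antisymm (iInf₂_le z hz') (le_iInf₂ fun z' hz'' => ?_)⟩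
  exact_mod_cast hmin z' (by simpa using hz'')

theorem opt_le {v : ι → Request m} {z : Finset (Fin m)} (hz : ∀ i, (v i).SatisfiedBy z) :
    opt v ≤ z.card :=
  iInf₂_le z hz

end Optimum

/-- There are only finitely many requests. -/
noncomputable instance requestFintype : Fintype (Request m) :=
  Fintype.ofInjective
    (fun r : Request m => ((r.row, ⟨r.demand, by
      have := r.satisfiable.trans (Finset.card_le_univ _)
      rw [Fintype.card_fin] at this
      omega⟩) : Finset (Fin m) × Fin (m + 1))) (by
    rintro ⟨a, b, h⟩ ⟨a', b', h'⟩ heq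
    simp only [Prod.mk.injEq, Fin.mk.injEq] at heq
    simp [heq.1, heq.2])

/-! ### Two disjoint runs and the exchange of samples with fresh draws. -/

section TwoRuns

variable {ι : Type} [Fintype ι] [DecidableEq ι] {N h : ℕ} [Nonempty (Fin N ≃ ι)]
  [Nonempty (Fin h)]

/-- The union of two learner runs, on the first `j` and on the last `j` requests of a random order,
for a random `j < h`. -/
noncomputable def twoRuns (hm : 1 ≤ m) (N h : ℕ) [Nonempty (Fin N ≃ ι)] [Nonempty (Fin h)]
    (s : ι → Request m) : PMF (Finset (Fin m)) :=
  (PMF.uniformOfFintype (Fin N ≃ ι)).bind fun e =>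
    (PMF.uniformOfFintype (Fin h)).bind fun j =>
      (learner hm (pre (s ∘ e) j)).bind fun X =>
        (learner hm (pre (s ∘ (Fin.revPerm.trans e)) j)).map fun Y => X ∪ Y

/-- The expected deficit of `r` after a learner run of random length on a random order, where the
runs that use the sample `p` are left out. -/
noncomputable def lossWithout (hm : 1 ≤ m) (N h : ℕ) [Nonempty (Fin N ≃ ι)] [Nonempty (Fin h)]
    (p : ι) (s : ι → Request m) (r : Request m) : ℝ≥0∞ :=
  expect (PMF.uniformOfFintype (Fin N ≃ ι)) fun e =>
    expect (PMF.uniformOfFintype (Fin h)) fun j =>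
      if (j : ℕ) ≤ e.symm p then learnerLoss hm (pre (s ∘ e) j) r else 0

/-- A run that counts stops before the position of `p` in the order, so it never reads `s p`. This
is the hypothesis of `expectIndep_fresh`. -/
theorem lossWithout_update (hm : 1 ≤ m) (p : ι) (s : ι → Request m) (x : Request m) :
    lossWithout hm N h p (Function.update s p x) = lossWithout hm N h p s := by
  ext r
  unfold lossWithout
  congr 1
  ext e
  congr 1
  ext j
  split_ifs with hj
  · congr 1
    refine pre_congr fun i hi => ?_
    have : e i ≠ p := by
      rintro rfl
      rw [Equiv.symm_apply_apply] at hj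
      omega
    simp [Function.update_of_ne this]
  · rfl

theorem expect_twoRuns_card_le (hm : 1 ≤ m) {s : ι → Request m} {z : Finset (Fin m)}
    (hz : ∀ i, (s i).SatisfiedBy z) :
    (expect (twoRuns hm N h s) fun X => (X.card : ℝ≥0∞)) ≤
      2 * (ENNReal.ofReal (learnerRatio m) * z.card) := by
  have hone : ∀ (e : Fin N ≃ ι) (j : ℕ),
      (expect (learner hm (pre (s ∘ e) j)) fun X => (X.card : ℝ≥0∞)) ≤
        ENNReal.ofReal (learnerRatio m) * z.card := by
    intro e j
    refine learner_card_le hm fun r hr => ?_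
    obtain ⟨i, rfl⟩ := mem_pre hr
    exact hz _
  simp only [twoRuns, expect_bind, expect_map]
  rw [← expect_const (PMF.uniformOfFintype (Fin N ≃ ι))
    (2 * (ENNReal.ofReal (learnerRatio m) * z.card))]
  refine expect_mono _ fun e => ?_
  rw [← expect_const (PMF.uniformOfFintype (Fin h))
    (2 * (ENNReal.ofReal (learnerRatio m) * z.card))]
  refine expect_mono _ fun j => ?_
  calc _ ≤ expect (learner hm (pre (s ∘ e) j)) fun X =>
        expect (learner hm (pre (s ∘ (Fin.revPerm.trans e)) j)) fun Y =>
          ((X.card : ℝ≥0∞) + (Y.card : ℝ≥0∞)) :=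
        expect_mono _ fun X => expect_mono _ fun Y => by exact_mod_cast Finset.card_union_le X Y
    _ ≤ _ := by
        simp only [expect_add, expect_const]
        rw [two_mul]
        exact add_le_add (hone e j) (hone _ j)

/-- Since `j < h` and `2 * h ≤ N + 1`, the two runs read disjoint positions, so at least one of them
avoids `p`; its deficit bounds that of the union. The reversed order is again uniform, so both runs
contribute the same `lossWithout`. -/
theorem expect_twoRuns_deficit_le (hm : 1 ≤ m) (hN : 2 * h ≤ N + 1) (p : ι) (s : ι → Request m)
    (r : Request m) :
    (expect (twoRuns hm N h s) fun X => (r.deficit X : ℝ≥0∞)) ≤ 2 * lossWithout hm N h p s r := by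
  have hrev : lossWithout hm N h p s r = expect (PMF.uniformOfFintype (Fin N ≃ ι)) fun e =>
      expect (PMF.uniformOfFintype (Fin h)) fun j =>
        if (j : ℕ) ≤ (Fin.revPerm.trans e).symm p
        then learnerLoss hm (pre (s ∘ (Fin.revPerm.trans e)) j) r else 0 :=
    (expect_uniformOfFintype_equiv (Equiv.equivCongr Fin.revPerm (Equiv.refl ι))
      fun e => expect (PMF.uniformOfFintype (Fin h)) fun j =>
        if (j : ℕ) ≤ e.symm p then learnerLoss hm (pre (s ∘ e) j) r else 0).symm
  rw [two_mul]
  nth_rw 2 [hrev]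
  rw [lossWithout, ← expect_add]
  simp only [twoRuns, expect_bind, expect_map]
  refine expect_mono _ fun e => ?_
  rw [← expect_add]
  refine expect_mono _ fun j => ?_
  have hX : (expect (learner hm (pre (s ∘ e) j)) fun X =>
      expect (learner hm (pre (s ∘ (Fin.revPerm.trans e)) j)) fun Y =>
        (r.deficit (X ∪ Y) : ℝ≥0∞)) ≤ learnerLoss hm (pre (s ∘ e) j) r := by
    refine expect_mono _ fun X => ?_
    rw [← expect_const (learner hm (pre (s ∘ (Fin.revPerm.trans e)) j)) (r.deficit X : ℝ≥0∞)]
    exact expect_mono _ fun Y => by exact_mod_cast r.deficit_anti Finset.subset_union_left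
  have hY : (expect (learner hm (pre (s ∘ e) j)) fun X =>
      expect (learner hm (pre (s ∘ (Fin.revPerm.trans e)) j)) fun Y =>
        (r.deficit (X ∪ Y) : ℝ≥0∞)) ≤
      learnerLoss hm (pre (s ∘ (Fin.revPerm.trans e)) j) r := by
    rw [← expect_const (learner hm (pre (s ∘ e) j))
      (learnerLoss hm (pre (s ∘ (Fin.revPerm.trans e)) j) r)]
    refine expect_mono _ fun X => expect_mono _ fun Y => ?_
    exact_mod_cast r.deficit_anti Finset.subset_union_right
  by_cases h1 : (j : ℕ) ≤ e.symm p
  · rw [if_pos h1]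
    exact hX.trans le_self_add
  · have h2 : (j : ℕ) ≤ (Fin.revPerm.trans e).symm p := by
      have h3 : ((Fin.revPerm.trans e).symm p : ℕ) = N - (e.symm p + 1) := by
        simp [Fin.val_rev]
      have := j.2
      omega
    rw [if_pos h2]
    exact hY.trans le_add_self

/-- Summing over samples is summing over their positions `q ≥ j`. The random run length gives the
factor `1 / h`, and `N / h ≤ 2`. -/
theorem sum_lossWithout_le (hm : 1 ≤ m) (hN : h ≤ N) (hN' : N ≤ 2 * h) {s : ι → Request m}
    {z : Finset (Fin m)} (hz : ∀ i, (s i).SatisfiedBy z) :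
    ∑ p, lossWithout hm N h p s (s p) ≤ 2 * (ENNReal.ofReal (learnerRatio m) * z.card) := by
  have h0 : 0 < h := Fin.pos (Classical.arbitrary (Fin h))
  have hswap : ∑ p, lossWithout hm N h p s (s p) =
      (h : ℝ≥0∞)⁻¹ * ∑ j : Fin h, ∑ q : Fin N with Fin.castLE hN j ≤ q,
        (expect (PMF.uniformOfFintype (Fin N ≃ ι)) fun e =>
          learnerLoss hm (pre (s ∘ e) j) (s (e q))) := by
    simp only [lossWithout]
    rw [← expect_sum]
    simp only [← expect_sum (Finset.filter _ _), ← expect_sum Finset.univ]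
    rw [← expect_mul_left]
    congr 1
    ext e
    rw [expect_uniformOfFintype, Fintype.card_fin]
    congr 1
    refine Finset.sum_congr rfl fun j _ => ?_
    rw [← e.sum_comp, Finset.sum_filter]
    simp [Fin.le_def]
  rw [hswap]
  calc _ ≤ (h : ℝ≥0∞)⁻¹ * (N * (ENNReal.ofReal (learnerRatio m) * z.card)) :=
        mul_le_mul_right (sum_learnerLoss_remaining_le hm s hz hN) _
    _ ≤ (h : ℝ≥0∞)⁻¹ * ((2 * h) * (ENNReal.ofReal (learnerRatio m) * z.card)) := by
        gcongr
        exact_mod_cast hN'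
    _ = _ := by
        rw [mul_assoc 2, mul_left_comm _ 2, ← mul_assoc _ (h : ℝ≥0∞), ENNReal.inv_mul_cancel,
          one_mul]
        · exact_mod_cast h0.ne'
        · exact ENNReal.natCast_ne_top h

/-- Fresh draws from the distributions of the samples have a small total expected deficit. -/
theorem expectIndep_twoRuns_le (hm : 1 ≤ m) (hN : h ≤ N) (hN' : N ≤ 2 * h) (hN2 : 2 * h ≤ N + 1)
    (D : ι → PMF (Request m)) :
    (expectIndep D fun s => (expect (twoRuns hm N h s) fun X => (X.card : ℝ≥0∞)) +
      ∑ p, expect (D p) fun r => expect (twoRuns hm N h s) fun X => (r.deficit X : ℝ≥0∞)) ≤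
      6 * ENNReal.ofReal (learnerRatio m) * expectIndep D opt := by
  have hcard : (expectIndep D fun s => expect (twoRuns hm N h s) fun X => (X.card : ℝ≥0∞)) ≤
      2 * ENNReal.ofReal (learnerRatio m) * expectIndep D opt := by
    simp only [expectIndep_eq_expect]
    rw [← expect_mul_left]
    refine expect_mono _ fun s => ?_
    obtain ⟨z, hz, hopt⟩ := exists_opt_eq s
    rw [hopt, mul_assoc]
    exact expect_twoRuns_card_le hm hz
  have hloss : (expectIndep D fun s => ∑ p, expect (D p) fun r =>
      expect (twoRuns hm N h s) fun X => (r.deficit X : ℝ≥0∞)) ≤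
      4 * ENNReal.ofReal (learnerRatio m) * expectIndep D opt := by
    calc _ ≤ expectIndep D fun s => ∑ p, expect (D p) fun r => 2 * lossWithout hm N h p s r := by
          simp only [expectIndep_eq_expect]
          exact expect_mono _ fun s => Finset.sum_le_sum fun p _ => expect_mono _ fun r =>
            expect_twoRuns_deficit_le hm hN2 p s r
      _ = 2 * ∑ p, expectIndep D fun s => expect (D p) (lossWithout hm N h p s) := by
          simp only [expectIndep_eq_expect, expect_sum, Finset.mul_sum, expect_mul_left]
      -- Here the fresh request is replaced by the sample `p` itself, which turns the online loss
      -- into a loss on the samples.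
      _ = 2 * ∑ p, expectIndep D fun s => lossWithout hm N h p s (s p) := by
          congr 1
          exact Finset.sum_congr rfl fun p _ =>
            expectIndep_fresh D p _ fun s x => lossWithout_update hm p s x
      _ = 2 * expectIndep D fun s => ∑ p, lossWithout hm N h p s (s p) := by
          simp only [expectIndep_eq_expect, expect_sum]
      _ ≤ 2 * expectIndep D fun s => 2 * ENNReal.ofReal (learnerRatio m) * opt s := by
          refine mul_le_mul_right ?_ _
          simp only [expectIndep_eq_expect]
          refine expect_mono _ fun s => ?_
          obtain ⟨z, hz, hopt⟩ := exists_opt_eq s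
          rw [hopt, mul_assoc]
          exact sum_lossWithout_le hm hN hN' hz
      _ = _ := by
          simp only [expectIndep_eq_expect, expect_mul_left]
          ring
  simp only [expectIndep_eq_expect, expect_add] at hcard hloss ⊢
  refine (add_le_add hcard hloss).trans_eq ?_
  ring

end TwoRuns

/-! ### The single-sample and 2-stage prophet settings. -/

section Prophet

/-- There is a random proposal, a function of `k` samples of each distribution, whose expected size
together with `k` times the expected deficit of the requests is small. -/
theorem exists_proposal (hm : 1 ≤ m) {n k : ℕ} (hn : 1 ≤ n) (hk : 1 ≤ k) :
    ∃ (Seed : Type) (law : PMF Seed) (X : Seed → (Fin k × Fin n → Request m) → Finset (Fin m)),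
      ∀ D : Fin n → PMF (Request m),
        (expectIndep (fun p : Fin k × Fin n => D p.2) fun s => expectIndep D fun v =>
          expect law fun ω => ((X ω s).card : ℝ≥0∞) +
            k * (((List.ofFn v).map fun r => r.deficit (X ω s)).sum : ℕ)) ≤
        6 * ENNReal.ofReal (learnerRatio m) *
          expectIndep (fun p : Fin k × Fin n => D p.2) opt := by
  classical
  have : Nonempty (Fin (k * n) ≃ Fin k × Fin n) := ⟨finProdFinEquiv.symm⟩
  have hN : 0 < k * n := Nat.mul_pos hk hn
  -- Half of the number of samples, rounded up: small enough for disjoint runs, large enough for `k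
  -- * n ≤ 2 * h`.
  set h := (k * n + 1) / 2 with hh
  have : Nonempty (Fin h) := ⟨⟨0, by omega⟩⟩
  obtain ⟨law, hlaw⟩ := exists_seed
    (twoRuns hm (k * n) h : (Fin k × Fin n → Request m) → PMF (Finset (Fin m)))
  refine ⟨_, law, fun ω s => ω s, fun D => ?_⟩
  refine le_of_eq_of_le ?_ (expectIndep_twoRuns_le hm (N := k * n) (h := h) (by omega) (by omega)
    (by omega) fun p : Fin k × Fin n => D p.2)
  congr 1
  ext s
  -- Each distribution occurs `k` times among the samples; this is where the weight `k` on the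
  -- online deficits comes from.
  rw [Fintype.sum_prod_type]
  simp only [Finset.sum_const, Finset.card_univ, Fintype.card_fin, nsmul_eq_mul]
  have hv : ∀ v : Fin n → Request m, (expect law fun ω => ((ω s).card : ℝ≥0∞) +
      k * (((List.ofFn v).map fun r => r.deficit (ω s)).sum : ℕ)) =
      (expect (twoRuns hm (k * n) h s) fun X => (X.card : ℝ≥0∞)) +
      k * ∑ t, expect (twoRuns hm (k * n) h s) fun X => ((v t).deficit X : ℝ≥0∞) := by
    intro v
    rw [hlaw s fun X => (X.card : ℝ≥0∞) + k * (((List.ofFn v).map fun r => r.deficit X).sum : ℕ)]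
    simp only [List.map_ofFn, List.sum_ofFn, Function.comp_apply, Nat.cast_sum, expect_add,
      expect_mul_left, expect_sum]
  simp only [hv]
  rw [expectIndep_eq_expect, expect_add, expect_const, expect_mul_left, expect_sum]
  congr 2
  refine Finset.sum_congr rfl fun t _ => ?_
  exact expectIndep_coordinate D t fun r =>
    expect (twoRuns hm (k * n) h s) fun X => (r.deficit X : ℝ≥0∞)

theorem exists_prophet_algorithm (hm : 1 ≤ m) {n : ℕ} (hn : 1 ≤ n) :
    ∃ A : SampleAlgorithm m n 1, A.AlwaysServes ∧ ∀ D : Fin n → PMF (Request m),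
      prophetCost A D ≤ 6 * ENNReal.ofReal (learnerRatio m) * expectIndep D opt := by
  obtain ⟨Seed, law, X, hX⟩ := exists_proposal hm hn le_rfl
  refine ⟨proposalAlgorithm law X true, proposalAlgorithm_alwaysServes law X true, fun D => ?_⟩
  have hopt : expectIndep (fun p : Fin 1 × Fin n => D p.2) opt = expectIndep D opt := by
    rw [← expectIndep_row D (0 : Fin 1) opt]
    congr 1
    ext s
    refine le_antisymm ?_ ?_
    · obtain ⟨z, hz, h⟩ := exists_opt_eq fun t => s (0, t)
      rw [h]
      refine opt_le fun p => ?_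
      obtain ⟨i, t⟩ := p
      rw [Subsingleton.elim i 0]
      exact hz t
    · obtain ⟨z, hz, h⟩ := exists_opt_eq s
      rw [h]
      exact opt_le fun t => hz _
  rw [← hopt]
  refine le_trans ?_ (hX D)
  simp only [prophetCost, expectIndep_eq_expect]
  refine expect_mono _ fun s => expect_mono _ fun v => ?_
  simpa using proposalAlgorithm_cost_le law X true s (List.ofFn v)

/-- Serving all the samples with the decisions of an online policy bounds the offline optimum of
the samples. -/
theorem expectIndep_opt_le_policy {n k : ℕ} {D : Fin n → PMF (Request m)} {B : Policy m}
    (hB : B.ServesAlmostSurely D) :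
    expectIndep (fun p : Fin k × Fin n => D p.2) opt ≤
      (expect B.law fun ω => ((B.initial ω ()).card : ℝ≥0∞)) +
      k * expectIndep D fun v => expect B.law fun ω =>
        ((B.online ω () (List.ofFn v) \ B.initial ω ()).card : ℝ≥0∞) := by
  classical
  have hopt : ∀ s ∈ (productPMF fun p : Fin k × Fin n => D p.2).support, opt s ≤
      expect B.law fun ω => ((B.initial ω ()).card : ℝ≥0∞) +
        ∑ i, ((B.online ω () (List.ofFn fun t => s (i, t)) \ B.initial ω ()).card : ℝ≥0∞) := by
    intro s hs
    rw [mem_support_productPMF] at hs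
    rw [← expect_const B.law (opt s)]
    refine expect_mono_support _ fun ω hω => ?_
    -- All rows use the same seed, and the initial purchases precede the requests, so they are
    -- shared and paid only once.
    refine (opt_le (z := B.initial ω () ∪ Finset.univ.biUnion fun i =>
      (B.online ω () (List.ofFn fun t => s (i, t)) \ B.initial ω ())) ?_).trans ?_
    · rintro ⟨i, t⟩
      have hserve := hB ω hω (fun t => s (i, t)) (fun t => hs (i, t)) _ (List.prefix_refl _)
        (s (i, t)) (by simp)
      refine hserve.mono ?_
      intro x hx
      simp only [OnlineAlgorithm.held, Finset.mem_union, Finset.mem_biUnion, Finset.mem_univ,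
        true_and, Finset.mem_sdiff] at hx ⊢
      by_cases h0 : x ∈ B.initial ω ()
      · exact Or.inl h0
      · exact Or.inr ⟨i, hx.resolve_left h0, h0⟩
    · exact_mod_cast (Finset.card_union_le _ _).trans
        (Nat.add_le_add_left Finset.card_biUnion_le _)
  calc expectIndep (fun p : Fin k × Fin n => D p.2) opt
      ≤ _ := expect_mono_support _ hopt
    _ = (expect B.law fun ω => ((B.initial ω ()).card : ℝ≥0∞)) +
          ∑ i : Fin k, expectIndep (fun p : Fin k × Fin n => D p.2) fun s =>
            expect B.law fun ω =>
              ((B.online ω () (List.ofFn fun t => s (i, t)) \ B.initial ω ()).card : ℝ≥0∞) := by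
        simp only [expectIndep_eq_expect, expect_add, expect_sum, expect_const]
    _ = _ := by
        congr 1
        have hrow : ∀ i : Fin k, (expectIndep (fun p : Fin k × Fin n => D p.2) fun s =>
            expect B.law fun ω =>
              ((B.online ω () (List.ofFn fun t => s (i, t)) \ B.initial ω ()).card : ℝ≥0∞)) =
            expectIndep D fun v => expect B.law fun ω =>
              ((B.online ω () (List.ofFn v) \ B.initial ω ()).card : ℝ≥0∞) := fun i =>
          expectIndep_row D i fun v => expect B.law fun ω =>
              ((B.online ω () (List.ofFn v) \ B.initial ω ()).card : ℝ≥0∞)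
        simp only [hrow, Finset.sum_const, Finset.card_univ, Fintype.card_fin, nsmul_eq_mul]

theorem policy_twoStageProphetCost_eq {n : ℕ} (B : Policy m) (c : ℝ≥0∞)
    (D : Fin n → PMF (Request m)) :
    Policy.twoStageProphetCost B c D =
      (expect B.law fun ω => ((B.initial ω ()).card : ℝ≥0∞)) +
      c * expectIndep D fun v => expect B.law fun ω =>
        ((B.online ω () (List.ofFn v) \ B.initial ω ()).card : ℝ≥0∞) := by
  simp only [Policy.twoStageProphetCost, OnlineAlgorithm.twoStageCost, expectIndep_eq_expect,
    expect_add, expect_mul_left, expect_const]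

/-- For `c ≥ 1` the proposal is bought upfront, and `c ≤ ⌈c⌉₊ ≤ 2 * c` costs a factor two. For `c ≤
1` there is one sample per distribution; everything is bought online at price `c`, which is no
dearer than the policy's prices in either stage. -/
theorem exists_twoStage_algorithm (hm : 1 ≤ m) {n : ℕ} (hn : 1 ≤ n) {c : ℝ} (hc : 0 < c) :
    ∃ A : SampleAlgorithm m n ⌈c⌉₊, A.AlwaysServes ∧
      ∀ (D : Fin n → PMF (Request m)) (B : Policy m), B.ServesAlmostSurely D →
        twoStageProphetCost A (ENNReal.ofReal c) D ≤
          12 * ENNReal.ofReal (learnerRatio m) *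
            Policy.twoStageProphetCost B (ENNReal.ofReal c) D := by
  have hk : 1 ≤ ⌈c⌉₊ := Nat.one_le_iff_ne_zero.2 (Nat.ceil_pos.2 hc).ne'
  obtain ⟨Seed, law, X, hX⟩ := exists_proposal hm hn hk
  have hk1 : (1 : ℝ≥0∞) ≤ (⌈c⌉₊ : ℝ≥0∞) := by exact_mod_cast hk
  rcases le_total 1 c with h1 | h1
  · refine ⟨proposalAlgorithm law X true, proposalAlgorithm_alwaysServes law X true,
      fun D B hB => ?_⟩
    have hck : ENNReal.ofReal c ≤ (⌈c⌉₊ : ℝ≥0∞) := by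
      rw [← ENNReal.ofReal_natCast]
      exact ENNReal.ofReal_le_ofReal (Nat.le_ceil c)
    have hkc : (⌈c⌉₊ : ℝ≥0∞) ≤ 2 * ENNReal.ofReal c := by
      rw [← ENNReal.ofReal_natCast, ← ENNReal.ofReal_ofNat 2, ← ENNReal.ofReal_mul zero_le_two]
      exact ENNReal.ofReal_le_ofReal (by linarith [Nat.ceil_lt_add_one hc.le])
    have hopt : expectIndep (fun p : Fin ⌈c⌉₊ × Fin n => D p.2) opt ≤
        2 * Policy.twoStageProphetCost B (ENNReal.ofReal c) D := by
      refine (expectIndep_opt_le_policy hB).trans ?_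
      rw [policy_twoStageProphetCost_eq, mul_add, ← mul_assoc]
      exact add_le_add (le_mul_of_one_le_left zero_le one_le_two) (mul_le_mul_left hkc _)
    calc twoStageProphetCost (proposalAlgorithm law X true) (ENNReal.ofReal c) D
        ≤ _ := by
          refine le_trans ?_ (hX D)
          simp only [twoStageProphetCost, expectIndep_eq_expect]
          refine expect_mono _ fun s => expect_mono _ fun v => ?_
          refine (proposalAlgorithm_twoStageCost_eager_le law X _ s (List.ofFn v)).trans ?_
          exact expect_mono _ fun ω => add_le_add le_rfl (mul_le_mul_left hck _)
      _ ≤ 6 * ENNReal.ofReal (learnerRatio m) *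
            (2 * Policy.twoStageProphetCost B (ENNReal.ofReal c) D) := mul_le_mul_right hopt _
      _ = _ := by ring
  · refine ⟨proposalAlgorithm law X false, proposalAlgorithm_alwaysServes law X false,
      fun D B hB => ?_⟩
    have hk2 : ⌈c⌉₊ = 1 := le_antisymm (Nat.ceil_le.2 (by simpa using h1)) hk
    have hc1 : ENNReal.ofReal c ≤ 1 := by simpa using h1
    have hopt : ENNReal.ofReal c * expectIndep (fun p : Fin ⌈c⌉₊ × Fin n => D p.2) opt ≤
        Policy.twoStageProphetCost B (ENNReal.ofReal c) D := by
      refine (mul_le_mul_right (expectIndep_opt_le_policy hB) _).trans ?_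
      rw [policy_twoStageProphetCost_eq, mul_add]
      refine add_le_add (mul_le_of_le_one_left zero_le hc1) (mul_le_mul_right ?_ _)
      rw [hk2, Nat.cast_one, one_mul]
    calc twoStageProphetCost (proposalAlgorithm law X false) (ENNReal.ofReal c) D
        ≤ ENNReal.ofReal c * (6 * ENNReal.ofReal (learnerRatio m) *
            expectIndep (fun p : Fin ⌈c⌉₊ × Fin n => D p.2) opt) := by
          refine le_trans ?_ (mul_le_mul_right (hX D) _)
          simp only [twoStageProphetCost, expectIndep_eq_expect, ← expect_mul_left]
          refine expect_mono _ fun s => expect_mono _ fun v => ?_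
          refine (proposalAlgorithm_twoStageCost_lazy_le law X _ s (List.ofFn v)).trans ?_
          rw [← expect_mul_left]
          refine expect_mono _ fun ω => mul_le_mul_right (add_le_add le_rfl ?_) _
          exact le_mul_of_one_le_left zero_le hk1
      _ = 6 * ENNReal.ofReal (learnerRatio m) *
            (ENNReal.ofReal c * expectIndep (fun p : Fin ⌈c⌉₊ × Fin n => D p.2) opt) := by ring
      _ ≤ 12 * ENNReal.ofReal (learnerRatio m) *
            Policy.twoStageProphetCost B (ENNReal.ofReal c) D := by
          gcongr
          norm_num

end Prophet

/-! ### Uniform subsets as images under random permutations. -/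

section RandomSubset

/-- Equal multiplicities give bijections between the fibres. Hence a multiset of samples determines
its arrangement up to a permutation. -/
theorem exists_perm_of_map_univ_eq {α β : Type} [Fintype α] {f g : α → β}
    (h : (Finset.univ : Finset α).val.map f = (Finset.univ : Finset α).val.map g) :
    ∃ τ : Equiv.Perm α, f = g ∘ τ := by
  classical
  have hcard : ∀ c, Fintype.card {a // f a = c} = Fintype.card {a // g a = c} := by
    intro c
    have := congrArg (Multiset.count c) h
    rw [Multiset.count_map, Multiset.count_map] at this
    rw [Fintype.card_subtype, Fintype.card_subtype]
    simpa only [Finset.card_def, Finset.filter_val, eq_comm] using this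
  exact ⟨Equiv.ofFiberEquiv fun c => Fintype.equivOfCardEq (hcard c),
    funext fun a => (Equiv.ofFiberEquiv_map _ a).symm⟩

/-- The image of a fixed subset under a random permutation is a uniformly random subset of the
same size. -/
theorem sum_powersetCard_div_choose {α : Type} [Fintype α] [DecidableEq α] (S₀ : Finset α)
    (G : Finset α → ℝ≥0∞) :
    (∑ S ∈ Finset.powersetCard S₀.card (Finset.univ : Finset α), G S) /
        ((Fintype.card α).choose S₀.card : ℝ≥0∞) =
      expect (PMF.uniformOfFintype (Equiv.Perm α)) fun π => G (S₀.map π.toEmbedding) := by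
  set P := Finset.powersetCard S₀.card (Finset.univ : Finset α) with hP
  set c := (Finset.univ.filter fun π : Equiv.Perm α => S₀.map π.toEmbedding = S₀).card with hc
  have hmem : ∀ π : Equiv.Perm α, S₀.map π.toEmbedding ∈ P := fun π => by
    simp [hP, Finset.mem_powersetCard]
  -- Composing with a permutation that carries `S₀` to `S` shows that all fibres have the same size.
  have hfib : ∀ S ∈ P,
      (Finset.univ.filter fun π : Equiv.Perm α => S₀.map π.toEmbedding = S).card = c := by
    intro S hS
    obtain ⟨ρ, hρ⟩ := Equiv.Perm.exists_map_finset_eq S₀ S (Finset.mem_powersetCard.1 hS).2.symm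
    symm
    refine Finset.card_bij (fun π _ => π.trans ρ) ?_ ?_ ?_
    · intro π hπ
      simp only [Finset.mem_filter, Finset.mem_univ, true_and] at hπ ⊢
      rw [Equiv.trans_toEmbedding, ← Finset.map_map, hπ, hρ]
    · intro π _ π' _ h
      ext x
      exact ρ.injective (congrArg (fun σ : Equiv.Perm α => σ x) h)
    · intro π hπ
      refine ⟨π.trans ρ.symm, ?_, by ext x; simp⟩
      simp only [Finset.mem_filter, Finset.mem_univ, true_and] at hπ ⊢
      rw [Equiv.trans_toEmbedding, ← Finset.map_map, hπ, ← hρ, Finset.map_map,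
        ← Equiv.trans_toEmbedding, Equiv.self_trans_symm]
      simp
  have hsum : ∀ F : Finset α → ℝ≥0∞,
      ∑ π : Equiv.Perm α, F (S₀.map π.toEmbedding) = c * ∑ S ∈ P, F S := by
    intro F
    rw [← Finset.sum_fiberwise_of_maps_to (fun π _ => hmem π), Finset.mul_sum]
    refine Finset.sum_congr rfl fun S hS => ?_
    rw [Finset.sum_congr rfl fun π hπ => by rw [(Finset.mem_filter.1 hπ).2], Finset.sum_const,
      hfib S hS, nsmul_eq_mul]
  have hcard : (Fintype.card (Equiv.Perm α) : ℝ≥0∞) =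
      c * ((Fintype.card α).choose S₀.card : ℝ≥0∞) := by
    have := hsum fun _ => 1
    rw [Finset.sum_const, Finset.sum_const, Finset.card_univ, hP, Finset.card_powersetCard,
      Finset.card_univ] at this
    simpa using this
  have hc0 : (c : ℝ≥0∞) ≠ 0 := by
    intro h
    rw [h, zero_mul] at hcard
    exact Fintype.card_ne_zero (Nat.cast_eq_zero.1 hcard)
  rw [expect_uniformOfFintype, hsum, hcard, ENNReal.mul_inv (Or.inl hc0)
    (Or.inl (ENNReal.natCast_ne_top c)), mul_mul_mul_comm, ENNReal.inv_mul_cancel hc0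
    (ENNReal.natCast_ne_top c), one_mul, mul_comm, ENNReal.div_eq_inv_mul, mul_comm]

end RandomSubset

/-! ### The learner on a uniformly random sample of positions. -/

section WithSample

/-- All positions but the first `k`. -/
def latePositions (n k : ℕ) : Finset (Fin n) :=
  Finset.univ.filter fun q => k ≤ (q : ℕ)

theorem mem_latePositions {n k : ℕ} {q : Fin n} : q ∈ latePositions n k ↔ k ≤ (q : ℕ) := by
  simp [latePositions]

variable {k : ℕ} [Nonempty (Fin k)]

/-- A learner run of random length on the requests `f` in random order. -/
noncomputable def sampleRun (hm : 1 ≤ m) (f : Fin k → Request m) : PMF (Finset (Fin m)) :=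
  (PMF.uniformOfFintype (Equiv.Perm (Fin k))).bind fun τ =>
    (PMF.uniformOfFintype (Fin k)).bind fun j => learner hm (pre (f ∘ τ) j)

theorem expect_sampleRun (hm : 1 ≤ m) (f : Fin k → Request m) (g : Finset (Fin m) → ℝ≥0∞) :
    expect (sampleRun hm f) g = expect (PMF.uniformOfFintype (Equiv.Perm (Fin k))) fun τ =>
      expect (PMF.uniformOfFintype (Fin k)) fun j => expect (learner hm (pre (f ∘ τ) j)) g := by
  simp only [sampleRun, expect_bind]

/-- The run shuffles its input, so the arrangement chosen for the revealed multiset is immaterial.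
-/
theorem expect_sampleRun_comp_perm (hm : 1 ≤ m) (f : Fin k → Request m)
    (τ₀ : Equiv.Perm (Fin k)) (g : Finset (Fin m) → ℝ≥0∞) :
    expect (sampleRun hm (f ∘ τ₀)) g = expect (sampleRun hm f) g := by
  rw [expect_sampleRun, expect_sampleRun]
  exact expect_uniformOfFintype_equiv (Equiv.mulLeft τ₀) fun τ =>
    expect (PMF.uniformOfFintype (Fin k)) fun j => expect (learner hm (pre (f ∘ τ) j)) g

theorem expect_sampleRun_card_le (hm : 1 ≤ m) {f : Fin k → Request m} {z : Finset (Fin m)}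
    (hz : ∀ i, (f i).SatisfiedBy z) :
    (expect (sampleRun hm f) fun X => (X.card : ℝ≥0∞)) ≤
      ENNReal.ofReal (learnerRatio m) * z.card := by
  rw [expect_sampleRun, ← expect_const (PMF.uniformOfFintype (Equiv.Perm (Fin k)))
    (ENNReal.ofReal (learnerRatio m) * z.card)]
  refine expect_mono _ fun τ => ?_
  rw [← expect_const (PMF.uniformOfFintype (Fin k)) (ENNReal.ofReal (learnerRatio m) * z.card)]
  refine expect_mono _ fun j => learner_card_le hm fun r hr => ?_
  obtain ⟨i, rfl⟩ := mem_pre hr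
  exact hz _

theorem pre_castLE {N k : ℕ} (hk : k ≤ N) (v : Fin N → Request m) {j : ℕ} (hj : j ≤ k) :
    pre (v ∘ Fin.castLE hk) j = pre v j := by
  refine List.ext_getElem (by simp [pre]; omega) fun i hi hi' => ?_
  simp [pre]

/-- The total expected deficit of the requests outside a random sample. -/
theorem expect_sampleRun_deficit_le (hm : 1 ≤ m) {n : ℕ} (hk : k ≤ n) (v : Fin n → Request m)
    {z : Finset (Fin m)} (hz : ∀ i, (v i).SatisfiedBy z) :
    (expect (PMF.uniformOfFintype (Equiv.Perm (Fin n))) fun π =>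
      ∑ q ∈ latePositions n k, expect (sampleRun hm (v ∘ π ∘ Fin.castLE hk)) fun X =>
        ((v (π q)).deficit X : ℝ≥0∞)) ≤
      (k : ℝ≥0∞)⁻¹ * (n * (ENNReal.ofReal (learnerRatio m) * z.card)) := by
  set H : Equiv.Perm (Fin n) → ℝ≥0∞ := fun π => expect (PMF.uniformOfFintype (Fin k)) fun j =>
    ∑ q ∈ latePositions n k, learnerLoss hm (pre (v ∘ π) j) (v (π q)) with hH
  -- The internal shuffle of the sample extends to a permutation of all positions that fixes the
  -- late ones; it is then absorbed into the uniform `π`.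
  have hext : ∀ (π : Equiv.Perm (Fin n)), (∑ q ∈ latePositions n k,
      expect (sampleRun hm (v ∘ π ∘ Fin.castLE hk)) fun X => ((v (π q)).deficit X : ℝ≥0∞)) =
      expect (PMF.uniformOfFintype (Equiv.Perm (Fin k))) fun τ =>
        H (π * τ.viaFintypeEmbedding (Fin.castLEEmb hk)) := by
    intro π
    simp only [expect_sampleRun, hH]
    rw [← expect_sum]
    congr 1
    ext τ
    rw [← expect_sum]
    congr 1
    ext j
    refine Finset.sum_congr rfl fun q hq => ?_
    set τ' := τ.viaFintypeEmbedding (Fin.castLEEmb hk) with hτ'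
    have hq' : τ' q = q := by
      refine Equiv.Perm.viaFintypeEmbedding_apply_notMem_range _ _ ?_
      rintro ⟨i, rfl⟩
      have := mem_latePositions.1 hq
      simp at this
      omega
    have hcomp : (v ∘ π ∘ Fin.castLE hk) ∘ τ = (v ∘ (π * τ')) ∘ Fin.castLE hk := by
      ext1 i
      have : τ' (Fin.castLE hk i) = Fin.castLE hk (τ i) :=
        Equiv.Perm.viaFintypeEmbedding_apply_image τ (Fin.castLEEmb hk) i
      simp [this]
    rw [learnerLoss, hcomp, pre_castLE hk _ j.2.le, Equiv.Perm.mul_apply, hq']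
  simp only [hext]
  rw [expect_comm]
  have hinv : ∀ τ' : Equiv.Perm (Fin n),
      (expect (PMF.uniformOfFintype (Equiv.Perm (Fin n))) fun π => H (π * τ')) =
      expect (PMF.uniformOfFintype (Equiv.Perm (Fin n))) H := fun τ' =>
    expect_uniformOfFintype_equiv (Equiv.mulRight τ') H
  simp only [hinv, expect_const]
  simp only [hH, expect_uniformOfFintype (Ω := Fin k), Fintype.card_fin]
  rw [expect_mul_left, expect_sum]
  refine mul_le_mul_right (le_trans (Finset.sum_le_sum fun j _ => ?_)
    (sum_learnerLoss_remaining_le hm v hz hk)) _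
  rw [expect_sum]
  refine Finset.sum_le_sum_of_subset fun q hq => ?_
  simp only [Finset.mem_filter, Finset.mem_univ, true_and, Fin.le_def, Fin.val_castLE]
  exact j.2.le.trans (mem_latePositions.1 hq)

end WithSample

/-! ### The algorithm for the online-with-a-sample setting. -/

section WithSampleAlgorithm

/-- A cheapest solution that satisfies the requests of the multiset. -/
noncomputable def cheapest (s : Multiset (Request m)) : Finset (Fin m) :=
  (exists_opt_eq fun r : {r // r ∈ s} => r.1).choose

theorem satisfiedBy_cheapest {s : Multiset (Request m)} {r : Request m} (hr : r ∈ s) :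
    r.SatisfiedBy (cheapest s) :=
  (exists_opt_eq fun r : {r // r ∈ s} => r.1).choose_spec.1 ⟨r, hr⟩

theorem card_cheapest_le {s : Multiset (Request m)} {z : Finset (Fin m)}
    (hz : ∀ r ∈ s, r.SatisfiedBy z) : ((cheapest s).card : ℝ≥0∞) ≤ z.card := by
  rw [cheapest, ← (exists_opt_eq fun r : {r // r ∈ s} => r.1).choose_spec.2]
  exact opt_le fun r => hz r.1 r.2

theorem sum_map_arrivalOrder {n : ℕ} {σ : Finset (Fin n) → List (Fin n)} (hσ : IsArrivalOrder σ)
    (S : Finset (Fin n)) (f : Fin n → ℕ) : ((σ S).map f).sum = ∑ i ∈ Sᶜ, f i := by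
  have h : Sᶜ = (σ S).toFinset := by
    ext i
    rw [List.mem_toFinset, (hσ S).2, Finset.mem_compl]
  rw [h, List.sum_toFinset f (hσ S).1]

open scoped Classical in
/-- The proposal that is drawn from the seed `ω` for a multiset of `k` sampled requests, together
with a cheapest solution for the sample. -/
noncomputable def sampleProposal (k : ℕ) (ω : (Fin k → Request m) → Finset (Fin m))
    (s : Multiset (Request m)) : Finset (Fin m) :=
  cheapest s ∪ if h : ∃ f : Fin k → Request m, (Finset.univ : Finset (Fin k)).val.map f = s
    then ω h.choose else ∅

theorem exists_arrangement {k : ℕ} (f : Fin k → Request m) :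
    ∃ τ : Equiv.Perm (Fin k), ∀ ω : (Fin k → Request m) → Finset (Fin m),
      sampleProposal k ω ((Finset.univ : Finset (Fin k)).val.map f) =
        cheapest ((Finset.univ : Finset (Fin k)).val.map f) ∪ ω (f ∘ τ) := by
  have h : ∃ g : Fin k → Request m, (Finset.univ : Finset (Fin k)).val.map g =
    (Finset.univ : Finset (Fin k)).val.map f := ⟨f, rfl⟩
  obtain ⟨τ, hτ⟩ := exists_perm_of_map_univ_eq h.choose_spec
  refine ⟨τ, fun ω => ?_⟩
  rw [sampleProposal, dif_pos h, hτ]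

theorem exists_withSample_algorithm (hm : 1 ≤ m) {n k : ℕ} (hk : 1 ≤ k) (hkn : k ≤ n) :
    ∃ A : OnlineAlgorithm m (Multiset (Request m)), A.AlwaysServes ∧
      (∀ (ω : A.Seed) (s : Multiset (Request m)), ∀ r ∈ s, r.SatisfiedBy (A.initial ω s)) ∧
      ∀ (v : Fin n → Request m) (σ : Finset (Fin n) → List (Fin n)), IsArrivalOrder σ →
        withSampleCost A k v σ ≤ (1 + ENNReal.ofReal (learnerRatio m) +
          (k : ℝ≥0∞)⁻¹ * (n * ENNReal.ofReal (learnerRatio m))) * opt v := by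
  classical
  have : Nonempty (Fin k) := ⟨⟨0, hk⟩⟩
  obtain ⟨law, hlaw⟩ := exists_seed
    (sampleRun hm : (Fin k → Request m) → PMF (Finset (Fin m)))
  refine ⟨proposalAlgorithm law (sampleProposal k) true,
    proposalAlgorithm_alwaysServes law (sampleProposal k) true, ?_, fun v σ hσ => ?_⟩
  · intro ω s r hr
    refine (satisfiedBy_cheapest hr).mono ?_
    simp only [proposalAlgorithm, if_true, sampleProposal]
    exact Finset.subset_union_left
  obtain ⟨z, hz, hopt⟩ := exists_opt_eq v
  set A := proposalAlgorithm law (sampleProposal k) true with hA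
  -- The sample is realized as the image of the first `k` positions under a random permutation; the
  -- late positions are then the online requests.
  set S₀ : Finset (Fin n) := Finset.univ.map (Fin.castLEEmb hkn) with hS₀
  have hS₀card : S₀.card = k := by simp [hS₀]
  have hcost := sum_powersetCard_div_choose S₀ fun S => A.cost (S.val.map v) ((σ S).map v)
  rw [hS₀card, Fintype.card_fin] at hcost
  rw [withSampleCost, hcost, hopt]
  have hπ : ∀ π : Equiv.Perm (Fin n),
      A.cost ((S₀.map π.toEmbedding).val.map v) ((σ (S₀.map π.toEmbedding)).map v) ≤
      (1 + ENNReal.ofReal (learnerRatio m)) * z.card +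
        ∑ q ∈ latePositions n k, expect (sampleRun hm (v ∘ π ∘ Fin.castLE hkn)) fun X =>
          ((v (π q)).deficit X : ℝ≥0∞) := by
    intro π
    set S := S₀.map π.toEmbedding with hS
    have hSv : S.val.map v =
        (Finset.univ : Finset (Fin k)).val.map (v ∘ π ∘ Fin.castLE hkn) := by
      simp [hS, hS₀, Finset.map_val, Function.comp_def]
    have hSc : Sᶜ = (latePositions n k).map π.toEmbedding := by
      ext i
      simp only [hS, hS₀, Finset.mem_compl, Finset.mem_map, Finset.mem_univ, true_and,
        mem_latePositions, Equiv.coe_toEmbedding]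
      constructor
      · intro h
        refine ⟨π.symm i, ?_, by simp⟩
        by_contra hlt
        exact h ⟨π.symm i, ⟨⟨π.symm i, not_le.1 hlt⟩, rfl⟩, by simp⟩
      · rintro ⟨q, hq, rfl⟩ ⟨q', ⟨i, rfl⟩, h⟩
        rw [π.injective.eq_iff] at h
        rw [← h] at hq
        simp at hq
        omega
    obtain ⟨τ, hτ⟩ := exists_arrangement (v ∘ π ∘ Fin.castLE hkn)
    rw [← hSv] at hτ
    refine (proposalAlgorithm_cost_le law (sampleProposal k) true _ _).trans ?_
    calc _ ≤ expect law fun ω => (z.card : ℝ≥0∞) +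
          (((ω ((v ∘ π ∘ Fin.castLE hkn) ∘ τ)).card : ℝ≥0∞) +
            ∑ q ∈ latePositions n k,
              ((v (π q)).deficit (ω ((v ∘ π ∘ Fin.castLE hkn) ∘ τ)) : ℝ≥0∞)) := by
          refine expect_mono _ fun ω => ?_
          rw [hτ, ← add_assoc]
          refine add_le_add ?_ ?_
          · have h1 : ((cheapest (S.val.map v)).card : ℝ≥0∞) ≤ z.card := by
              refine card_cheapest_le fun r hr => ?_
              obtain ⟨i, _, rfl⟩ := Multiset.mem_map.1 hr
              exact hz i
            refine le_trans ?_ (add_le_add h1 le_rfl)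
            exact_mod_cast Finset.card_union_le _ _
          · rw [List.map_map, sum_map_arrivalOrder hσ, hSc, Finset.sum_map, Nat.cast_sum]
            refine Finset.sum_le_sum fun q _ => ?_
            exact_mod_cast Request.deficit_anti _ Finset.subset_union_right
      _ = (z.card : ℝ≥0∞) + ((expect (sampleRun hm (v ∘ π ∘ Fin.castLE hkn)) fun X =>
            (X.card : ℝ≥0∞)) + ∑ q ∈ latePositions n k,
              expect (sampleRun hm (v ∘ π ∘ Fin.castLE hkn)) fun X =>
                ((v (π q)).deficit X : ℝ≥0∞)) := by
          rw [expect_add, expect_const, hlaw _ fun X => (X.card : ℝ≥0∞) +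
            ∑ q ∈ latePositions n k, ((v (π q)).deficit X : ℝ≥0∞),
            expect_sampleRun_comp_perm, expect_add, expect_sum]
      _ ≤ _ := by
          rw [← add_assoc, add_mul, one_mul]
          exact add_le_add (add_le_add le_rfl (expect_sampleRun_card_le hm fun i => hz _)) le_rfl
  refine (expect_mono _ hπ).trans ?_
  rw [expect_add, expect_const, add_mul (1 + ENNReal.ofReal (learnerRatio m))]
  refine add_le_add le_rfl ((expect_sampleRun_deficit_le hm hkn v hz).trans_eq ?_)
  ring

/-- Without a sample every request is served on its own. -/
theorem exists_withoutSample_algorithm (m n : ℕ) :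
    ∃ A : OnlineAlgorithm m (Multiset (Request m)), A.AlwaysServes ∧
      (∀ (ω : A.Seed) (s : Multiset (Request m)), ∀ r ∈ s, r.SatisfiedBy (A.initial ω s)) ∧
      ∀ (v : Fin n → Request m) (σ : Finset (Fin n) → List (Fin n)), IsArrivalOrder σ →
        withSampleCost A 0 v σ ≤ n * opt v := by
  refine ⟨proposalAlgorithm (PMF.pure ()) (fun _ s => cheapest s) true,
    proposalAlgorithm_alwaysServes _ _ true, ?_, fun v σ hσ => ?_⟩
  · intro ω s r hr
    simpa [proposalAlgorithm] using satisfiedBy_cheapest hr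
  obtain ⟨z, hz, hopt⟩ := exists_opt_eq v
  rw [withSampleCost, Finset.powersetCard_zero, Finset.sum_singleton, Nat.choose_zero_right,
    Nat.cast_one, div_one, hopt]
  refine (proposalAlgorithm_cost_le _ _ true _ _).trans ?_
  rw [expect_pure, List.map_map, sum_map_arrivalOrder hσ]
  have h1 : ((cheapest ((∅ : Finset (Fin n)).val.map v)).card : ℝ≥0∞) ≤ 0 := by
    have := card_cheapest_le (s := (∅ : Finset (Fin n)).val.map v) (z := ∅) (by simp)
    simpa using this
  have h2 : ∑ i ∈ (∅ : Finset (Fin n))ᶜ,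
      ((fun r => r.deficit (cheapest ((∅ : Finset (Fin n)).val.map v))) ∘ v) i ≤ n * z.card := by
    have := Finset.sum_le_card_nsmul (∅ : Finset (Fin n))ᶜ
      ((fun r => r.deficit (cheapest ((∅ : Finset (Fin n)).val.map v))) ∘ v) z.card
      fun i _ => le_trans ((v i).deficit_le_demand _) (hz i).demand_le_card
    simpa using this
  calc _ ≤ 0 + ((n * z.card : ℕ) : ℝ≥0∞) := add_le_add h1 (by exact_mod_cast h2)
    _ = _ := by push_cast; ring

end WithSampleAlgorithm

end SetMulticover

/-! ### The constants of the three settings. -/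

theorem mainTheorem10 :
    ∃ C : ℝ, 0 < C ∧ ∀ m n : ℕ, 2 ≤ m * n →
      -- single-sample prophet setting
      (∃ A : SetMulticover.SampleAlgorithm m n 1, A.AlwaysServes ∧
        ∀ D : Fin n → PMF (SetMulticover.Request m),
          SetMulticover.prophetCost A D ≤
            ENNReal.ofReal (C * Real.log (m * n)) *
              SetMulticover.expectIndep D SetMulticover.opt) ∧
      -- 2-stage prophet setting, compared with every online policy
      (∀ c : ℝ, 0 < c → ∃ A : SetMulticover.SampleAlgorithm m n ⌈c⌉₊, A.AlwaysServes ∧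
        ∀ (D : Fin n → PMF (SetMulticover.Request m)) (B : SetMulticover.Policy m),
          SetMulticover.Policy.ServesAlmostSurely B D →
          SetMulticover.twoStageProphetCost A (ENNReal.ofReal c) D ≤
            ENNReal.ofReal (C * Real.log (m * n)) *
              SetMulticover.Policy.twoStageProphetCost B (ENNReal.ofReal c) D) ∧
      -- online-with-a-sample setting
      (∀ α : ℝ, 0 < α → α ≤ 1 →
        ∃ A : SetMulticover.OnlineAlgorithm m (Multiset (SetMulticover.Request m)),
          A.AlwaysServes ∧
          (∀ (ω : A.Seed) (s : Multiset (SetMulticover.Request m)), ∀ r ∈ s,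
            r.SatisfiedBy (A.initial ω s)) ∧
          ∀ (v : Fin n → SetMulticover.Request m) (σ : Finset (Fin n) → List (Fin n)),
            SetMulticover.IsArrivalOrder σ →
            SetMulticover.withSampleCost A ⌊α * n⌋₊ v σ ≤
              ENNReal.ofReal (C * Real.log (m * n) / α) * SetMulticover.opt v) := by
  -- `216 = 12 * 18`: the factor `12` of the 2-stage setting times the bound on `learnerRatio`. The
  -- other settings need less.
  refine ⟨216, by norm_num, fun m n hmn => ?_⟩
  have hm : 1 ≤ m := Nat.pos_of_ne_zero (by rintro rfl; simp at hmn)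
  have hn : 1 ≤ n := Nat.pos_of_ne_zero (by rintro rfl; simp at hmn)
  have hK := SetMulticover.learnerRatio_le hmn
  have hK5 : 5 ≤ SetMulticover.learnerRatio m := by
    have hlog : 0 ≤ Real.log (2 * m) := by
      refine Real.log_nonneg ?_
      have : (1 : ℝ) ≤ m := by exact_mod_cast hm
      linarith
    have : (0 : ℝ) ≤ Nat.clog 2 m := Nat.cast_nonneg _
    unfold SetMulticover.learnerRatio
    linarith
  have hmul : ∀ a : ℕ, a ≤ 12 →
      (a : ℝ≥0∞) * ENNReal.ofReal (SetMulticover.learnerRatio m) ≤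
        ENNReal.ofReal (216 * Real.log (m * n)) := by
    intro a ha
    rw [← ENNReal.ofReal_natCast, ← ENNReal.ofReal_mul (Nat.cast_nonneg _)]
    refine ENNReal.ofReal_le_ofReal ?_
    have : (a : ℝ) ≤ 12 := by exact_mod_cast ha
    nlinarith
  refine ⟨?_, fun c hc => ?_, fun α hα hα1 => ?_⟩
  · obtain ⟨A, hA, hcost⟩ := SetMulticover.exists_prophet_algorithm hm hn
    refine ⟨A, hA, fun D => (hcost D).trans (mul_le_mul_left ?_ _)⟩
    exact_mod_cast hmul 6 (by norm_num)
  · obtain ⟨A, hA, hcost⟩ := SetMulticover.exists_twoStage_algorithm hm hn hc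
    refine ⟨A, hA, fun D B hB => (hcost D B hB).trans (mul_le_mul_left ?_ _)⟩
    exact_mod_cast hmul 12 le_rfl
  · have hαn : 0 ≤ α * n := by positivity
    -- With an empty sample `α * n < 1`, so even the trivial ratio `n` is below `1 / α`.
    rcases Nat.eq_zero_or_pos ⌊α * n⌋₊ with h0 | hpos
    · rw [h0]
      obtain ⟨A, hA, hinit, hcost⟩ := SetMulticover.exists_withoutSample_algorithm m n
      refine ⟨A, hA, hinit, fun v σ hσ => (hcost v σ hσ).trans (mul_le_mul_left ?_ _)⟩
      rw [← ENNReal.ofReal_natCast]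
      refine ENNReal.ofReal_le_ofReal ?_
      rw [le_div_iff₀ hα]
      have := Nat.floor_eq_zero.1 h0
      nlinarith
    · have hkn : ⌊α * n⌋₊ ≤ n :=
        Nat.floor_le_of_le (mul_le_of_le_one_left (Nat.cast_nonneg n) hα1)
      obtain ⟨A, hA, hinit, hcost⟩ := SetMulticover.exists_withSample_algorithm hm hpos hkn
      refine ⟨A, hA, hinit, fun v σ hσ => (hcost v σ hσ).trans (mul_le_mul_left ?_ _)⟩
      have hk0 : (0 : ℝ) < ⌊α * n⌋₊ := by exact_mod_cast hpos
      have hk1 : (1 : ℝ) ≤ ⌊α * n⌋₊ := by exact_mod_cast hpos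
      have hKpos : 0 ≤ SetMulticover.learnerRatio m := by linarith
      rw [← ENNReal.ofReal_natCast n, ← ENNReal.ofReal_natCast ⌊α * n⌋₊,
        ← ENNReal.ofReal_inv_of_pos hk0, ← ENNReal.ofReal_mul (Nat.cast_nonneg _),
        ← ENNReal.ofReal_mul (by positivity), ← ENNReal.ofReal_one,
        ← ENNReal.ofReal_add zero_le_one hKpos, ← ENNReal.ofReal_add (by positivity) (by positivity)]
      refine ENNReal.ofReal_le_ofReal ?_
      rw [le_div_iff₀ hα]
      -- The floor is at least one, so `α * n` is less than the floor plus one, hence at most twice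
      -- the floor.
      have hratio : (⌊α * n⌋₊ : ℝ)⁻¹ * (α * n) ≤ 2 := by
        rw [inv_mul_le_iff₀ hk0]
        linarith [Nat.lt_floor_add_one (α * n)]
      have h1 : (⌊α * n⌋₊ : ℝ)⁻¹ * (n * SetMulticover.learnerRatio m) * α ≤
          2 * SetMulticover.learnerRatio m := by
        calc _ = (⌊α * n⌋₊ : ℝ)⁻¹ * (α * n) * SetMulticover.learnerRatio m := by ring
          _ ≤ _ := mul_le_mul_of_nonneg_right hratio hKpos
      have h2 : (1 + SetMulticover.learnerRatio m) * α ≤ 1 + SetMulticover.learnerRatio m :=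
        mul_le_of_le_one_right (by linarith) hα1
      linarith
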